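/- Let $F_\infty$ be the free group on countably infinitely many generators, let $C^*(F_\infty)$ be its full group $C^*$-algebra, and let $\ell^2=\ell^2(\mathbb N)$ over $\mathbb C$. A \emph{bounded representation} of a $C^*$-algebra on a Hilbert space $K$ is a norm-bounded algebra homomorphism into $\mathcal B(K)$ (not assumed to preserve adjoints or units). Let $\phi : C^*(F_\infty)\to\mathcal B(\ell^2)$ be a bounded representation. Let $\mathcal H$ be a complex Hilbert space and let $\mathcal B(\ell^2)$ act on $\mathcal H$ as a von Neumann algebra: $\rho$ is a $*$-isomorphism of $\mathcal B(\ell^2)$ onto a von Neumann algebra $\mathcal M\subseteq\mathcal B(\mathcal H)$. Suppose that some $\xi\in\mathcal H$ is cyclic ($\overline{\mathcal M\xi}=\mathcal H$) and separating ($x\in\mathcal M$, $x\xi=0$ imply $x=0$) for $\mathcal M$. Let $\mathcal B\subseteq\mathcal M'$ be a (not necessarily unital) $C^*$-subalgebra that is dense in the commutant $\mathcal M'$ for the weak operator topology. Let $\otimes_{\max}$ denote the maximal $C^*$-tensor product, the completion of the algebraic tensor product for the norm $\|\sum_j a_j\otimes b_j\|_{\max}=\sup\|\sum_j\sigma(a_j)\tau(b_j)\|$,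 where the supremum is over all pairs $(\sigma,\tau)$ of $*$-representations of the two algebras on a common Hilbert space with commuting ranges. Then the following are equivalent: (1) $\phi$ is similar to a $*$-representation of $C^*(F_\infty)$ into $\mathcal B(\ell^2)$, i.e. there is an invertible $S\in\mathcal B(\ell^2)$ such that $S\phi(\cdot)S^{-1}$ is a $*$-homomorphism; (2) the formula $\Phi\bigl(\sum_{i=1}^n a_i\otimes b_i\bigr)=\sum_{i=1}^n\rho(\phi(a_i))\,b_i$ (with $a_i\in C^*(F_\infty)$, $b_i\in\mathcal B$) defines a bounded representation $\Phi : C^*(F_\infty)\otimes_{\max}\mathcal B\to\mathcal B(\mathcal H)$. -/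

import Mathlib

open scoped ENNReal

noncomputable section

universe u v

/-! ### The full group C⋆-algebra -/

/-- A unitary representation of a group on a (nonzero) complex Hilbert space. -/
structure UnitaryRep (G : Type u) [Group G] where
  /-- The Hilbert space of the representation. -/
  space : Type u
  [normedAddCommGroup : NormedAddCommGroup space]
  [innerProductSpace : InnerProductSpace ℂ space]
  [completeSpace : CompleteSpace space]
  [nontrivial : Nontrivial space]
  /-- The homomorphism into the unitary group. -/
  rep : G →* unitary (space →L[ℂ] space)

attribute [instance] UnitaryRep.normedAddCommGroup UnitaryRep.innerProductSpace
  UnitaryRep.completeSpace UnitaryRep.nontrivial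

/-- The ℓ^∞-product of the algebras `B(K)` over all unitary representations of `G` on a Hilbert
space `K`, i.e. the block diagonal operators on the space of the universal representation. -/
abbrev UniversalGroupProduct (G : Type u) [Group G] : Type (u + 1) :=
  lp (fun π : UnitaryRep G => π.space →L[ℂ] π.space) ∞

instance (G : Type u) [Group G] : CStarAlgebra (UniversalGroupProduct G) where

/-- The universal unitary representation: `g` is sent to the family `(π(g))_π`. -/
def universalUnitary {G : Type u} [Group G] (g : G) : UniversalGroupProduct G :=
  ⟨fun π => (π.rep g : π.space →L[ℂ] π.space),
    memℓp_infty ⟨1, by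
      rintro _ ⟨π, rfl⟩
      exact CStarRing.norm_of_mem_unitary (π.rep g).2 |>.le⟩⟩

/-- The full group C⋆-algebra `C*(G)` of a discrete group `G`: the norm closed ⋆-algebra generated
by the image of `G` under the universal unitary representation. Equivalently, it is the completion
of `ℂ[G]` for the norm `‖x‖ = sup_π ‖π(x)‖` over all unitary representations of `G`. -/
def fullGroupCStar (G : Type u) [Group G] : StarSubalgebra ℂ (UniversalGroupProduct G) :=
  (StarAlgebra.adjoin ℂ (Set.range (universalUnitary (G := G)))).topologicalClosure

instance (G : Type u) [Group G] : IsClosed (fullGroupCStar G : Set (UniversalGroupProduct G)) :=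
  StarSubalgebra.isClosed_topologicalClosure _

/-- `C*(F_∞)`, the full C⋆-algebra of the free group on countably infinitely many generators. -/
def CStarFInfty : Type 1 := fullGroupCStar (FreeGroup ℕ)

instance : CStarAlgebra CStarFInfty :=
  StarSubalgebra.cstarAlgebra (fullGroupCStar (FreeGroup ℕ))

/-! ### The maximal tensor product -/

/-- A pair of commuting ⋆-representations of `A` and `B` on a common Hilbert space. -/
structure CommutingPair (A : Type u) (B : Type v) [NonUnitalCStarAlgebra A]
    [NonUnitalCStarAlgebra B] where
  /-- The common Hilbert space. -/
  space : Type (max u v)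
  [normedAddCommGroup : NormedAddCommGroup space]
  [innerProductSpace : InnerProductSpace ℂ space]
  [completeSpace : CompleteSpace space]
  /-- The representation of `A`. -/
  left : A →⋆ₙₐ[ℂ] (space →L[ℂ] space)
  /-- The representation of `B`. -/
  right : B →⋆ₙₐ[ℂ] (space →L[ℂ] space)
  commute : ∀ a b, Commute (left a) (right b)

attribute [instance] CommutingPair.normedAddCommGroup CommutingPair.innerProductSpace
  CommutingPair.completeSpace

section MaxTensor

variable (A : Type u) (B : Type v) [NonUnitalCStarAlgebra A] [NonUnitalCStarAlgebra B]

/-- The ℓ^∞-product of the algebras `B(K)` over all commuting pairs of ⋆-representations of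
`A` and `B` on a Hilbert space `K`. -/
abbrev UniversalPairProduct : Type (max (u + 1) (v + 1)) :=
  lp (fun p : CommutingPair A B => p.space →L[ℂ] p.space) ∞

variable {A B} in
/-- The elementary tensor `a ⊗ b`, realized as the family `(φ(a)ψ(b))` over all commuting pairs
`(φ, ψ)` of ⋆-representations. -/
def universalTmul (a : A) (b : B) : UniversalPairProduct A B :=
  ⟨fun p => p.left a * p.right b,
    memℓp_infty ⟨‖a‖ * ‖b‖, by
      rintro _ ⟨p, rfl⟩
      exact (norm_mul_le _ _).trans (mul_le_mul (NonUnitalStarAlgHom.norm_apply_le p.left a)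
        (NonUnitalStarAlgHom.norm_apply_le p.right b) (norm_nonneg _) (norm_nonneg _))⟩⟩

/-- The maximal C⋆-tensor product `A ⊗_max B`: the closed ⋆-algebra generated by the elementary
tensors. The norm of `∑ aⱼ ⊗ bⱼ` is the supremum of `‖∑ φ(aⱼ) ψ(bⱼ)‖` over all commuting pairs
`(φ, ψ)` of ⋆-representations of `A` and `B`. -/
def maxTensorSubalgebra : NonUnitalStarSubalgebra ℂ (UniversalPairProduct A B) :=
  (NonUnitalStarAlgebra.adjoin ℂ
    (Set.range fun x : A × B => universalTmul x.1 x.2)).topologicalClosure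

instance : IsClosed (maxTensorSubalgebra A B : Set (UniversalPairProduct A B)) :=
  NonUnitalStarSubalgebra.isClosed_topologicalClosure _

/-- The C⋆-algebra `A ⊗_max B`. -/
def MaxTensor : Type (max (u + 1) (v + 1)) := maxTensorSubalgebra A B

instance : NonUnitalCStarAlgebra (MaxTensor A B) :=
  NonUnitalStarSubalgebra.nonUnitalCStarAlgebra (maxTensorSubalgebra A B)

variable {A B} in
/-- The elementary tensor `a ⊗ b` as an element of `A ⊗_max B`. -/
def maxTmul (a : A) (b : B) : MaxTensor A B :=
  ⟨universalTmul a b, NonUnitalStarSubalgebra.le_topologicalClosure _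
    (NonUnitalStarAlgebra.subset_adjoin ℂ _ ⟨(a, b), rfl⟩)⟩

end MaxTensor

/-! ### Bounded representations, similarity, vectors, weak density -/

/-- The Hilbert space `ℓ²(ℕ)` over `ℂ`. -/
abbrev EllTwo : Type := lp (fun _ : ℕ => ℂ) 2

section Operators

variable {A : Type u} [NonUnitalCStarAlgebra A]
variable {H : Type v} [NormedAddCommGroup H] [InnerProductSpace ℂ H] [CompleteSpace H]

/-- Boundedness of a representation (an algebra homomorphism into `B(H)`, not assumed to preserve
the involution, nor the unit). -/
def IsBoundedRep (φ : A →ₙₐ[ℂ] (H →L[ℂ] H)) : Prop :=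
  ∃ C : ℝ, ∀ a, ‖φ a‖ ≤ C * ‖a‖

/-- `φ` is similar to a ⋆-representation: `S φ(·) S⁻¹` is a ⋆-representation for some invertible
operator `S`. -/
def IsSimilarToStarRep (φ : A →ₙₐ[ℂ] (H →L[ℂ] H)) : Prop :=
  ∃ (S : (H →L[ℂ] H)ˣ) (π : A →⋆ₙₐ[ℂ] (H →L[ℂ] H)),
    ∀ a, π a = (S : H →L[ℂ] H) * φ a * ((S⁻¹ : (H →L[ℂ] H)ˣ) : H →L[ℂ] H)

/-- `ξ` is cyclic for `M`: the vectors `x ξ` with `x ∈ M` are dense. -/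
def IsCyclicVector (M : Set (H →L[ℂ] H)) (ξ : H) : Prop :=
  Dense ((fun x : H →L[ℂ] H => x ξ) '' M)

/-- `ξ` is separating for `M`: the only `x ∈ M` with `x ξ = 0` is `0`. -/
def IsSeparatingVector (M : Set (H →L[ℂ] H)) (ξ : H) : Prop :=
  ∀ x ∈ M, x ξ = 0 → x = 0

/-- `B` is a subset of `N` which is dense in `N` for the weak operator topology. -/
def IsWeaklyDenseIn (B N : Set (H →L[ℂ] H)) : Prop :=
  B ⊆ N ∧ ∀ x ∈ N, (ContinuousLinearMapWOT.ofCLM x : H →WOT[ℂ] H) ∈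
    closure ((fun y : H →L[ℂ] H => (ContinuousLinearMapWOT.ofCLM y : H →WOT[ℂ] H)) '' B)

end Operators

end

noncomputable section

universe u v

section Isometries

open InnerProductSpace

variable {H : Type*} [NormedAddCommGroup H] [InnerProductSpace ℂ H]

/-- The isometry permuting the vectors of a Hilbert basis along an injection. -/
def HilbertBasis.isometryOfInjective {κ : Type*} (b : HilbertBasis κ ℂ H) [CompleteSpace H]
    {g : κ → κ} (hg : Function.Injective g) : H →L[ℂ] H :=
  ((b.orthonormal.comp g hg).orthogonalFamily.linearIsometry.comp
    b.repr.toLinearIsometry).toContinuousLinearMap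

lemma HilbertBasis.isometryOfInjective_apply {κ : Type*} (b : HilbertBasis κ ℂ H)
    [CompleteSpace H] {g : κ → κ} (hg : Function.Injective g) (k : κ) :
    b.isometryOfInjective hg (b k) = b (g k) := by
  classical
  simp only [HilbertBasis.isometryOfInjective, LinearIsometry.coe_toContinuousLinearMap,
    LinearIsometry.coe_comp, Function.comp_apply, LinearIsometryEquiv.coe_toLinearIsometry,
    b.repr_self]
  rw [OrthogonalFamily.linearIsometry_apply_single]
  simp

lemma HilbertBasis.clm_ext {κ : Type*} (b : HilbertBasis κ ℂ H) {S T : H →L[ℂ] H}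
    (h : ∀ k, S (b k) = T (b k)) : S = T := by
  have hd : Dense (Submodule.span ℂ (Set.range b) : Set H) :=
    Submodule.dense_iff_topologicalClosure_eq_top.mpr b.dense_span
  refine ContinuousLinearMap.ext_on hd ?_
  rintro _ ⟨k, rfl⟩
  exact h k

lemma HilbertBasis.eq_of_inner {κ : Type*} (b : HilbertBasis κ ℂ H) {x y : H}
    (h : ∀ k, inner ℂ (b k) x = inner ℂ (b k) y) : x = y := by
  apply b.repr.injective
  ext k
  simpa [b.repr_apply_apply] using h k

lemma HilbertBasis.star_isometryOfInjective_mul {κ : Type*} (b : HilbertBasis κ ℂ H)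
    [CompleteSpace H] {f g : κ → κ} (hf : Function.Injective f) (hg : Function.Injective g)
    (hfg : ∀ x y, f x ≠ g y) :
    star (b.isometryOfInjective hf) * b.isometryOfInjective hg = 0 := by
  refine b.clm_ext fun k => b.eq_of_inner fun l => ?_
  simp [ContinuousLinearMap.star_eq_adjoint, ContinuousLinearMap.adjoint_inner_right,
    b.isometryOfInjective_apply, b.orthonormal.2 (hfg l k)]

lemma HilbertBasis.star_isometryOfInjective_mul_self {κ : Type*} (b : HilbertBasis κ ℂ H)
    [CompleteSpace H] {f : κ → κ} (hf : Function.Injective f) :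
    star (b.isometryOfInjective hf) * b.isometryOfInjective hf = 1 := by
  classical
  refine b.clm_ext fun k => b.eq_of_inner fun l => ?_
  simp [ContinuousLinearMap.star_eq_adjoint, ContinuousLinearMap.adjoint_inner_right,
    b.isometryOfInjective_apply, orthonormal_iff_ite.1 b.orthonormal, hf.eq_iff]

/-- The standard basis vectors of `ℓ²`. -/
def ellTwoBasis (i : ℕ) : EllTwo := lp.single 2 i 1

lemma inner_ellTwoBasis (i : ℕ) (x : EllTwo) : inner ℂ (ellTwoBasis i) x = x i := by
  rw [ellTwoBasis, lp.inner_single_left]; simp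

/-- The standard matrix units in `B(ℓ²)`. -/
def matrixUnit (i j : ℕ) : EllTwo →L[ℂ] EllTwo := rankOne ℂ (ellTwoBasis i) (ellTwoBasis j)

lemma matrixUnit_apply (i j : ℕ) (x : EllTwo) : matrixUnit i j x = x j • ellTwoBasis i := by
  simp [matrixUnit, inner_ellTwoBasis]

lemma ellTwoBasis_apply (i j : ℕ) : ellTwoBasis i j = if i = j then 1 else 0 := by
  simp [ellTwoBasis, lp.single_apply, Pi.single_apply, eq_comm]

lemma matrixUnit_mul (i j k l : ℕ) :
    matrixUnit i j * matrixUnit k l = if j = k then matrixUnit i l else 0 := by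
  ext1 x
  split_ifs with h
  · simp [matrixUnit_apply, ellTwoBasis_apply, h]
  · simp [matrixUnit_apply, ellTwoBasis_apply, Ne.symm h]

lemma star_matrixUnit (i j : ℕ) : star (matrixUnit i j) = matrixUnit j i := by
  simp [matrixUnit, ContinuousLinearMap.star_eq_adjoint]

lemma matrixUnit_mul_mul (i j k l : ℕ) (x : EllTwo →L[ℂ] EllTwo) :
    matrixUnit i j * x * matrixUnit k l = (x (ellTwoBasis k) j) • matrixUnit i l := by
  ext1 y
  simp [matrixUnit_apply, smul_smul, mul_comm]

lemma eq_zero_of_matrixUnit_mul {x : EllTwo →L[ℂ] EllTwo} (h : ∀ i, matrixUnit 0 i * x = 0) :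
    x = 0 := by
  ext y i
  have := congr($(h i) y 0)
  simpa [matrixUnit_apply, ellTwoBasis_apply] using this

variable [CompleteSpace H]

lemma matrixUnit_jointly_injective (M : VonNeumannAlgebra H)
    (ρ : (EllTwo →L[ℂ] EllTwo) ≃⋆ₐ[ℂ] M.toStarSubalgebra) {h : H}
    (hh : ∀ i, (ρ (matrixUnit 0 i) : H →L[ℂ] H) h = 0) : h = 0 := by
  let N : Submodule ℂ H := ⨅ i, (ρ (matrixUnit 0 i) : H →L[ℂ] H).ker
  have hNmem (x : H) : x ∈ N ↔ ∀ i, (ρ (matrixUnit 0 i) : H →L[ℂ] H) x = 0 := by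
    simp [N, Submodule.mem_iInf]
  have hNc : IsClosed (N : Set H) := by
    have : (N : Set H) = ⋂ i, {x | (ρ (matrixUnit 0 i) : H →L[ℂ] H) x = 0} := by
      ext x; simp [hNmem]
    rw [this]
    exact isClosed_iInter fun i => isClosed_eq (by fun_prop) continuous_const
  have : CompleteSpace N := hNc.completeSpace_coe
  let P : H →L[ℂ] H := N.starProjection
  have hP : P ∈ M := by
    rw [VonNeumannAlgebra.IsStarProjection.mem_iff isStarProjection_starProjection]
    intro y hy
    rw [Submodule.range_starProjection, Module.End.mem_invtSubmodule]
    intro x hx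
    simp only [Submodule.mem_comap]
    rw [hNmem] at hx ⊢
    intro i
    have h1 := VonNeumannAlgebra.mem_commutant_iff.1 hy _ (ρ (matrixUnit 0 i)).2
    have h2 := congr($h1 x)
    simp only [mul_apply_eq_comp, hx i, map_zero] at h2
    exact h2
  have hp : ρ.symm ⟨P, hP⟩ = 0 := by
    refine eq_zero_of_matrixUnit_mul fun i => EquivLike.injective ρ ?_
    rw [map_mul, map_zero, StarAlgEquiv.apply_symm_apply]
    ext1; ext1 x
    exact (hNmem _).1 (N.starProjection_apply_mem x) i
  have hP0 : P = 0 := by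
    have := congr(ρ $hp)
    rw [StarAlgEquiv.apply_symm_apply, map_zero] at this
    exact congr(($this : H →L[ℂ] H))
  have : P h = h := Submodule.starProjection_eq_self_iff.2 ((hNmem h).2 hh)
  simpa [hP0] using this.symm

/-- If `B(ℓ²)` acts on `H` with a separating vector, its commutant contains isometries with
pairwise orthogonal ranges. -/
theorem exists_isometries_mem_commutant (M : VonNeumannAlgebra H)
    (ρ : (EllTwo →L[ℂ] EllTwo) ≃⋆ₐ[ℂ] M.toStarSubalgebra)
    (ξ : H) (hsep : IsSeparatingVector (M : Set (H →L[ℂ] H)) ξ) :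
    ∃ v : ℕ → H →L[ℂ] H, (∀ k, v k ∈ M.commutant) ∧
      ∀ j k, star (v j) * v k = if j = k then 1 else 0 := by
  classical
  let E : ℕ → ℕ → H →L[ℂ] H := fun i j => (ρ (matrixUnit i j) : H →L[ℂ] H)
  have hE (i j : ℕ) : E i j = (ρ (matrixUnit i j) : H →L[ℂ] H) := rfl
  have hEmul (i j k l : ℕ) : E i j * E k l = if j = k then E i l else 0 := by
    have := congr((ρ $(matrixUnit_mul i j k l) : H →L[ℂ] H))
    rw [map_mul] at this
    split_ifs with h
    · simpa [h] using! this
    · simpa [h] using! this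
  have hEapp (i j k l : ℕ) (x : H) : E i j (E k l x) = if j = k then E i l x else 0 := by
    have := congr($(hEmul i j k l) x)
    split_ifs with h <;> simpa [h] using this
  have hEstar (i j : ℕ) : star (E i j) = E j i := by
    have := congr((ρ $(star_matrixUnit i j) : H →L[ℂ] H))
    rw [map_star] at this
    exact this
  have hEinner (i j : ℕ) (x y : H) : inner ℂ (E i j x) y = inner ℂ x (E j i y) := by
    rw [← hEstar i j, ContinuousLinearMap.star_eq_adjoint, ContinuousLinearMap.adjoint_inner_right]
  let L : Submodule ℂ H := (E 0 0 - 1).ker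
  have hL (x : H) : x ∈ L ↔ E 0 0 x = x := by simp [L, sub_eq_zero]
  have : CompleteSpace L := (E 0 0 - 1).isClosed_ker.completeSpace_coe
  obtain ⟨w, b, -⟩ := exists_hilbertBasis ℂ L
  -- `L` is infinite dimensional
  have hinf : Infinite w := by
    by_contra hfin
    rw [not_infinite_iff_finite] at hfin
    have := Fintype.ofFinite w
    have : FiniteDimensional ℂ L := (b.toOrthonormalBasis).toBasis.finiteDimensional_of_finite
    let y : ℕ → L := fun i => ⟨E 0 i ξ, by rw [hL, hEapp]; simp⟩
    have hdep : ¬ LinearIndependent ℂ y := fun h => by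
      have := h.finite
      exact not_finite ℕ
    rw [not_linearIndependent_iff] at hdep
    obtain ⟨s, c, hc, i, hi, hne⟩ := hdep
    let x : EllTwo →L[ℂ] EllTwo := ∑ i ∈ s, c i • matrixUnit 0 i
    have hx : (ρ x : H →L[ℂ] H) = ∑ i ∈ s, c i • E 0 i := by
      simp [x, E]
    have hx0 : (ρ x : H →L[ℂ] H) = 0 := by
      refine hsep _ (ρ x).2 ?_
      rw [hx]
      have := congr((($hc : L) : H))
      simpa [y] using this
    have hx1 : x = 0 := ρ.injective (by rw [map_zero]; exact Subtype.ext hx0)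
    apply hne
    have := congr($hx1 (ellTwoBasis i) 0)
    simpa [x, matrixUnit_apply, ellTwoBasis_apply, hi] using this
  have horth : Orthonormal ℂ fun k : ℕ × w => E k.1 0 (b k.2 : H) := by
    rw [orthonormal_iff_ite]
    rintro ⟨i, α⟩ ⟨j, β⟩
    rw [hEinner, hEapp]
    by_cases hij : i = j
    · have h2 := orthonormal_iff_ite.1 b.orthonormal α β
      rw [Submodule.coe_inner] at h2
      simp only [hij, if_true, (hL _).1 (b β).2, h2, Prod.mk.injEq, true_and]
    · simp [hij]
  have htot : (Submodule.span ℂ (Set.range fun k : ℕ × w => E k.1 0 (b k.2 : H)))ᗮ = ⊥ := by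
    rw [eq_bot_iff]
    intro h hh
    rw [Submodule.mem_orthogonal] at hh
    refine matrixUnit_jointly_injective M ρ fun i => ?_
    have hm : E 0 i h ∈ L := by rw [hL, hEapp]; simp
    have : (⟨E 0 i h, hm⟩ : L) = 0 := b.eq_of_inner fun α => by
      rw [Submodule.coe_inner, ← hEinner, inner_zero_right]
      exact hh _ (Submodule.subset_span ⟨(i, α), rfl⟩)
    exact congr(($this : H))
  let B := HilbertBasis.mkOfOrthogonalEqBot horth htot
  have hB (k : ℕ × w) : B k = E k.1 0 (b k.2 : H) := by simp [B]
  obtain ⟨e⟩ : Nonempty (ℕ × w ≃ w) := by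
    rw [← Cardinal.eq, Cardinal.mk_prod]
    simp
  have hf (k : ℕ) : Function.Injective fun x : ℕ × w => (x.1, e (k, x.2)) := by
    rintro ⟨i, α⟩ ⟨j, β⟩ h
    simpa using h
  refine ⟨fun k => B.isometryOfInjective (hf k), fun k => ?_, fun j k => ?_⟩
  · set v := B.isometryOfInjective (hf k) with hv
    have hvE (i j : ℕ) : v * E i j = E i j * v := by
      refine B.clm_ext fun ⟨l, α⟩ => ?_
      have h1 : E i j (B (l, α)) = if j = l then B (i, α) else 0 := by
        rw [hB, hEapp]; split_ifs <;> simp [hB]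
      have h2 : E i j (B (l, e (k, α))) = if j = l then B (i, e (k, α)) else 0 := by
        rw [hB, hEapp]; split_ifs <;> simp [hB]
      simp only [mul_apply_eq_comp, h1, hv, B.isometryOfInjective_apply, h2]
      split_ifs <;> simp [B.isometryOfInjective_apply]
    rw [VonNeumannAlgebra.mem_commutant_iff]
    intro g hg
    obtain ⟨x, hx⟩ := ρ.surjective ⟨g, hg⟩
    have hx' : (ρ x : H →L[ℂ] H) = g := congr(($hx : H →L[ℂ] H))
    have key (i j : ℕ) : E 0 i * g * E j 0 = (x (ellTwoBasis j) i) • E 0 0 := by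
      have := congr((ρ $(matrixUnit_mul_mul 0 i j 0 x) : H →L[ℂ] H))
      rw [map_mul, map_mul, map_smul] at this
      rw [← hx']
      exact this
    refine B.clm_ext fun ⟨j, α⟩ => ?_
    rw [hB, ← sub_eq_zero]
    refine matrixUnit_jointly_injective M ρ fun i => ?_
    rw [← hE]
    have : E 0 i * (g * v - v * g) * E j 0 = 0 := by
      have h1 : E 0 i * (g * v - v * g) * E j 0
          = E 0 i * g * (v * E j 0) - (E 0 i * v) * g * E j 0 := by noncomm_ring
      have h2 : E 0 i * g * (E j 0 * v) - v * E 0 i * g * E j 0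
          = (E 0 i * g * E j 0) * v - v * (E 0 i * g * E j 0) := by noncomm_ring
      rw [h1, hvE j 0, ← hvE 0 i, h2, key]
      simp [hvE]
    have := congr($this (b α))
    simpa using this
  · split_ifs with h
    · subst h; exact B.star_isometryOfInjective_mul_self _
    · refine B.star_isometryOfInjective_mul _ _ fun x y hxy => h ?_
      have := e.injective (Prod.ext_iff.1 hxy).2
      exact (Prod.ext_iff.1 this).1

end Isometries

section Kaplansky

open ContinuousLinearMapWOT

lemma IsWeaklyDenseIn.le_of_forall_le {H : Type*} [NormedAddCommGroup H] [InnerProductSpace ℂ H]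
    {B N : Set (H →L[ℂ] H)} (hB : IsWeaklyDenseIn B N) {F : (H →WOT[ℂ] H) → ℝ}
    (hF : Continuous F) {r : ℝ} (h : ∀ c ∈ B, F (ofCLM c) ≤ r) {x : H →L[ℂ] H} (hx : x ∈ N) :
    F (ofCLM x) ≤ r := by
  have hcl : IsClosed {T : H →WOT[ℂ] H | F T ≤ r} := isClosed_le hF continuous_const
  refine closure_minimal ?_ hcl (hB.2 x hx)
  rintro _ ⟨c, hc, rfl⟩
  exact h c hc

/-- Weak operator density of a ⋆-algebra implies density for the ⋆-strong topology. -/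
lemma IsWeaklyDenseIn.exists_star_strong_approx {H : Type*} [NormedAddCommGroup H]
    [InnerProductSpace ℂ H] [CompleteSpace H] {B : NonUnitalStarSubalgebra ℂ (H →L[ℂ] H)}
    {N : Set (H →L[ℂ] H)} (hB : IsWeaklyDenseIn (B : Set (H →L[ℂ] H)) N) {x : H →L[ℂ] H}
    (hx : x ∈ N) (η ζ : H) {ε : ℝ} (hε : 0 < ε) :
    ∃ c ∈ B, ‖c η - x η‖ < ε ∧ ‖star c ζ - star x ζ‖ < ε := by
  let W : Set (H × H) := (fun c : H →L[ℂ] H => (c η, star c ζ)) '' B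
  have hconv : Convex ℝ (closure W) := by
    refine Convex.closure ?_
    rintro _ ⟨c, hc, rfl⟩ _ ⟨d, hd, rfl⟩ s t - - -
    refine ⟨(s : ℂ) • c + (t : ℂ) • d, add_mem (SMulMemClass.smul_mem _ hc) (SMulMemClass.smul_mem _ hd), ?_⟩
    simp
  have hmem : (x η, star x ζ) ∈ closure W := by
    by_contra hn
    obtain ⟨f, u, hf1, hf2⟩ :=
      RCLike.geometric_hahn_banach_closed_point (𝕜 := ℂ) hconv isClosed_closure hn
    let f₁ : StrongDual ℂ H := f.comp (ContinuousLinearMap.inl ℂ H H)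
    let f₂ : StrongDual ℂ H := f.comp (ContinuousLinearMap.inr ℂ H H)
    let r := (InnerProductSpace.toDual ℂ H).symm f₂
    have hf (c : H →L[ℂ] H) : (f (c η, star c ζ)).re
        = (f₁ (c η)).re + (inner ℂ ζ (c r)).re := by
      have h1 : (c η, star c ζ) = (c η, 0) + (0, star c ζ) := by simp
      have h2 : f (0, star c ζ) = inner ℂ r (star c ζ) := by
        simp [r, InnerProductSpace.toDual_symm_apply, f₂]
      rw [h1, map_add, Complex.add_re, h2, ContinuousLinearMap.star_eq_adjoint,
        ContinuousLinearMap.adjoint_inner_right, ← inner_conj_symm, Complex.conj_re]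
      rfl
    have hcont : Continuous fun T : H →WOT[ℂ] H =>
        (f₁ (T η)).re + ((InnerProductSpace.toDual ℂ H ζ) (T r)).re :=
      (Complex.continuous_re.comp (continuous_dual_apply η f₁)).add
        (Complex.continuous_re.comp (continuous_dual_apply r _))
    have := hB.le_of_forall_le hcont (r := u) (fun c hc => by
      have := (hf1 _ (subset_closure ⟨c, hc, rfl⟩)).le
      simp only [RCLike.re_eq_complex_re, hf] at this
      simpa using this) hx
    simp only [RCLike.re_eq_complex_re, hf] at hf2
    refine absurd hf2 (not_lt.2 ?_)
    simpa using this
  obtain ⟨_, ⟨c, hc, rfl⟩, hd⟩ := Metric.mem_closure_iff.1 hmem ε hε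
  rw [dist_comm, Prod.dist_eq, max_lt_iff, dist_eq_norm, dist_eq_norm] at hd
  exact ⟨c, hc, hd⟩

lemma exists_resolvent {B : Type*} [NonUnitalCStarAlgebra B] {n : ℕ} (c : Fin n → B) :
    ∃ g : B, star g = g ∧ g + (∑ k, c k * star (c k)) * g = ∑ k, c k * star (c k) := by
  let _ := CStarAlgebra.spectralOrder B
  have := CStarAlgebra.spectralOrderedRing B
  set s := ∑ k, c k * star (c k)
  have hs : 0 ≤ s := Finset.sum_nonneg fun k _ => mul_star_self_nonneg _
  have hsa : IsSelfAdjoint s := hs.isSelfAdjoint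
  have hq : ∀ t ∈ quasispectrum ℝ s, 0 ≤ t := quasispectrum_nonneg_of_nonneg s hs
  have hc : ContinuousOn (fun t : ℝ => t / (1 + t)) (quasispectrum ℝ s) :=
    continuousOn_id.div (by fun_prop) fun t ht => by have := hq t ht; positivity
  let g := cfcₙ (fun t : ℝ => t / (1 + t)) s
  have hg : IsSelfAdjoint g := IsSelfAdjoint.cfcₙ
  have h1 : g + s * g = s := by
    have h2 : s * g = cfcₙ (fun t : ℝ => t * (t / (1 + t))) s := by
      rw [cfcₙ_mul _ _ s (by fun_prop) (by simp) hc (by simp), cfcₙ_id' ℝ s]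
    conv_rhs => rw [← cfcₙ_id' ℝ s]
    rw [h2]
    refine (cfcₙ_add _ _ s hc (by simp) (continuousOn_id.mul hc) (by simp)).symm.trans ?_
    refine cfcₙ_congr fun t ht => ?_
    have := hq t ht
    simp only [Pi.mul_apply, id]
    field_simp
  exact ⟨g, hg, h1⟩

section Resolvent

variable {K : Type*} [NormedAddCommGroup K] [InnerProductSpace ℂ K] [CompleteSpace K] {n : ℕ}
  (T : Fin n → K →L[ℂ] K) {g : K →L[ℂ] K}

lemma inner_sum_mul_star (u : K) :
    (inner ℂ ((∑ k, T k * star (T k)) u) u).re = ∑ k, ‖star (T k) u‖ ^ 2 := by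
  rw [sum_apply, sum_inner, Complex.re_sum]
  refine Finset.sum_congr rfl fun k _ => ?_
  rw [mul_apply_eq_comp, ContinuousLinearMap.star_eq_adjoint,
    ← ContinuousLinearMap.adjoint_inner_right, inner_self_eq_norm_sq_to_K]
  norm_cast

lemma norm_sub_resolvent_le (h : g + (∑ k, T k * star (T k)) * g = ∑ k, T k * star (T k))
    (x : K) : ‖x - g x‖ ≤ ‖x‖ := by
  set s := ∑ k, T k * star (T k) with hs
  set y := x - g x
  have hx : x = y + s y := by
    have := congr($h x)
    simp only [_root_.add_apply, mul_apply_eq_comp] at this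
    simp only [y, map_sub]
    rw [← this]; abel
  have h1 : 0 ≤ (inner ℂ (s y) y).re := by
    rw [hs, inner_sum_mul_star]; positivity
  have h2 : ‖x‖ ^ 2 = ‖y‖ ^ 2 + 2 * (inner ℂ (s y) y).re + ‖s y‖ ^ 2 := by
    conv_lhs => rw [hx, @norm_add_sq ℂ]
    rw [inner_re_symm]; simp
  exact le_of_sq_le_sq (by nlinarith [sq_nonneg ‖s y‖]) (norm_nonneg _)

lemma norm_row_resolvent_le (hg : star g = g)
    (h : g + (∑ k, T k * star (T k)) * g = ∑ k, T k * star (T k))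
    (w : Fin n → K) :
    4 * ‖∑ k, (T k (w k) - g (T k (w k)))‖ ^ 2 ≤ ∑ k, ‖w k‖ ^ 2 := by
  set s := ∑ k, T k * star (T k) with hs
  set x := ∑ k, T k (w k) with hxd
  have hxs : ∑ k, (T k (w k) - g (T k (w k))) = x - g x := by
    rw [Finset.sum_sub_distrib, hxd, map_sum]
  rw [hxs]
  set y := x - g x with hy
  set u := y - g y with hu
  have hyu : y = u + s u := by
    have := congr($h y)
    simp only [_root_.add_apply, mul_apply_eq_comp] at this
    simp only [u, map_sub]
    rw [← this]; abel
  have hsu : 4 * ∑ k, ‖star (T k) u‖ ^ 2 ≤ ‖y‖ ^ 2 := by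
    rw [← inner_sum_mul_star, ← hs]
    have h1 : ‖y‖ ^ 2 = ‖u‖ ^ 2 + 2 * (inner ℂ (s u) u).re + ‖s u‖ ^ 2 := by
      conv_lhs => rw [hyu, @norm_add_sq ℂ]
      rw [inner_re_symm]; simp
    have h2 : ‖u - s u‖ ^ 2 = ‖u‖ ^ 2 - 2 * (inner ℂ (s u) u).re + ‖s u‖ ^ 2 := by
      rw [@norm_sub_sq ℂ, inner_re_symm]; simp
    nlinarith [sq_nonneg ‖u - s u‖]
  have hyy : ‖y‖ ^ 2 = ∑ k, (inner ℂ (star (T k) u) (w k)).re := by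
    have h1 : inner ℂ y y = inner ℂ u x := by
      have h3 : inner ℂ y (g x) = inner ℂ (g y) x := by
        rw [← ContinuousLinearMap.adjoint_inner_left, ← ContinuousLinearMap.star_eq_adjoint, hg]
      calc inner ℂ y y = inner ℂ y x - inner ℂ y (g x) := by rw [← inner_sub_right]
        _ = inner ℂ u x := by rw [h3, ← inner_sub_left]
    have h2 := @inner_self_eq_norm_sq ℂ _ _ _ _ y
    rw [h1, hxd, inner_sum, map_sum] at h2
    rw [← h2]
    refine Finset.sum_congr rfl fun k _ => ?_
    rw [ContinuousLinearMap.star_eq_adjoint, ContinuousLinearMap.adjoint_inner_left]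
    rfl
  have hle : ‖y‖ ^ 2 ≤ ∑ k, (2 * ‖star (T k) u‖ ^ 2 + ‖w k‖ ^ 2 / 8) := by
    rw [hyy]
    refine Finset.sum_le_sum fun k _ => ?_
    have := re_inner_le_norm (𝕜 := ℂ) (star (T k) u) (w k)
    simp only [RCLike.re_eq_complex_re] at this
    nlinarith [sq_nonneg (4 * ‖star (T k) u‖ - ‖w k‖)]
  rw [Finset.sum_add_distrib, ← Finset.mul_sum, ← Finset.sum_div] at hle
  linarith

end Resolvent

/-- A Kaplansky type density theorem for rows: if `v k` are isometries with orthogonal ranges in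
the weak closure of `B`, then `∑ k, v k (η k)` is approximated by `∑ k, c k (η k)` for a row `c` in
`B` which is contractive in every representation of `B`. -/
theorem IsWeaklyDenseIn.exists_contractive_row {H : Type*} [NormedAddCommGroup H]
    [InnerProductSpace ℂ H] [CompleteSpace H] {B : NonUnitalStarSubalgebra ℂ (H →L[ℂ] H)}
    [IsClosed (B : Set (H →L[ℂ] H))]
    {N : Set (H →L[ℂ] H)} (hB : IsWeaklyDenseIn (B : Set (H →L[ℂ] H)) N) {v : ℕ → H →L[ℂ] H}
    (hvN : ∀ k, v k ∈ N) (hv : ∀ j k, star (v j) * v k = if j = k then 1 else 0)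
    {n : ℕ} (η : Fin n → H) {ε : ℝ} (hε : 0 < ε) :
    ∃ c : Fin n → B, (∀ (K : Type u) [NormedAddCommGroup K] [InnerProductSpace ℂ K]
        [CompleteSpace K] (R : B →⋆ₙₐ[ℂ] (K →L[ℂ] K)) (w : Fin n → K),
        ‖∑ k, R (c k) (w k)‖ ^ 2 ≤ ∑ k, ‖w k‖ ^ 2) ∧
      ‖∑ k : Fin n, v k (η k) - ∑ k, (c k : H →L[ℂ] H) (η k)‖ < ε := by
  set ζ := ∑ k : Fin n, v k (η k) with hζ
  have hvζ (k : Fin n) : star (v k) ζ = η k := by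
    rw [hζ, map_sum, Finset.sum_eq_single k]
    · have := congr($(hv k k) (η k)); simpa using this
    · intro j _ hj
      have := congr($(hv k j) (η j))
      rw [if_neg (fun h => hj (Fin.ext h.symm))] at this
      simpa using this
    · simp
  set δ := ε / (2 * n + 1) with hδ
  have hδ0 : 0 < δ := by positivity
  choose c hcB hc1 hc2 using fun k : Fin n =>
    hB.exists_star_strong_approx (hvN k) (η k) ζ hδ0
  let c' : Fin n → B := fun k => ⟨c k, hcB k⟩
  obtain ⟨g, hg, hgs⟩ := exists_resolvent c'
  refine ⟨fun k => (2 : ℂ) • (c' k - g * c' k), fun K _ _ _ R w => ?_, ?_⟩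
  · have h := norm_row_resolvent_le (fun k => R (c' k)) (g := R g) (by rw [← map_star, hg])
      (by simpa [map_star] using congr(R $hgs)) w
    simp only [map_smul, map_sub, map_mul, _root_.smul_apply,
      _root_.sub_apply, mul_apply_eq_comp]
    rw [← Finset.smul_sum, norm_smul, mul_pow]
    convert h using 2
    norm_num
  · set G := (g : H →L[ℂ] H) with hG
    have hgG : star G = G := congr(($hg : H →L[ℂ] H))
    have hgs' : G + (∑ k, c k * star (c k)) * G = ∑ k, c k * star (c k) := by
      have := congr(($hgs : H →L[ℂ] H))
      simpa [c'] using this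
    set s := ∑ k, c k * star (c k) with hs
    set d := ζ - ∑ k, c k (η k) with hd
    set w : Fin n → H := fun k => star (c k) ζ - η k with hw
    have hid : ζ - ∑ k, (((2 : ℂ) • (c' k - g * c' k) : B) : H →L[ℂ] H) (η k)
        = (d - G d) + ∑ k, (c k (w k) - G (c k (w k))) := by
      have h1 : ∑ k, (((2 : ℂ) • (c' k - g * c' k) : B) : H →L[ℂ] H) (η k)
          = (2 : ℂ) • (∑ k, c k (η k) - G (∑ k, c k (η k))) := by
        rw [map_sum, ← Finset.sum_sub_distrib, Finset.smul_sum]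
        rfl
      have h2 : ∑ k, (c k (w k) - G (c k (w k)))
          = (s ζ - ∑ k, c k (η k)) - G (s ζ - ∑ k, c k (η k)) := by
        rw [Finset.sum_sub_distrib, ← map_sum]
        have : ∑ k, c k (w k) = s ζ - ∑ k, c k (η k) := by
          simp [hw, hs, sum_apply]
        rw [this]
      have h3 : star (G + s * G) = star s := congr(star $hgs')
      have hss : star s = s := by simp [hs]
      rw [star_add, star_mul, hgG, hss] at h3
      have h4 := congr($h3 ζ)
      simp only [_root_.add_apply, mul_apply_eq_comp] at h4
      rw [h1, h2, hd, map_sub, map_sub, two_smul]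
      have h5 : s ζ = G ζ + G (s ζ) := h4.symm
      generalize G (s ζ) = t at h5 ⊢
      rw [h5]
      abel
    have hd1 : ‖d‖ ≤ n * δ := by
      rw [hd, hζ, ← Finset.sum_sub_distrib]
      have h : ∑ k : Fin n, ‖v k (η k) - c k (η k)‖ ≤ ∑ _k : Fin n, δ :=
        Finset.sum_le_sum fun k _ => ?_
      · exact (norm_sum_le _ _).trans (by simpa using h)
      rw [norm_sub_rev]
      exact (hc1 k).le
    have hw1 : ‖∑ k, (c k (w k) - G (c k (w k)))‖ ≤ n * δ := by
      have h1 := norm_row_resolvent_le c hgG hgs' w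
      have h2 : ∑ k, ‖w k‖ ^ 2 ≤ n * δ ^ 2 := by
        have h : ∑ k : Fin n, ‖w k‖ ^ 2 ≤ ∑ _k : Fin n, δ ^ 2 := Finset.sum_le_sum fun k _ => ?_
        · simpa using h
        have := (hc2 k).le
        rw [hvζ] at this
        exact pow_le_pow_left₀ (norm_nonneg _) this 2
      have h3 : (n : ℝ) ≤ n ^ 2 := by exact_mod_cast Nat.le_self_pow two_ne_zero n
      refine le_of_sq_le_sq ?_ (by positivity)
      nlinarith [sq_nonneg ‖∑ k, (c k (w k) - G (c k (w k)))‖, sq_nonneg δ]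
    rw [hid]
    calc _ ≤ ‖d - G d‖ + ‖∑ k, (c k (w k) - G (c k (w k)))‖ := norm_add_le _ _
      _ ≤ n * δ + n * δ := add_le_add ((norm_sub_resolvent_le c hgs' d).trans hd1) hw1
      _ < (2 * n + 1) * δ := by nlinarith
      _ = ε := by rw [hδ]; field_simp

end Kaplansky

section Domination

open scoped TensorProduct

/-- The linear map `a ⊗ b ↦ f(a) g(b)` on the algebraic tensor product. -/
def tensorMul {A B Y : Type*} [AddCommGroup A] [Module ℂ A] [AddCommGroup B] [Module ℂ B]
    [Ring Y] [Algebra ℂ Y] (f : A →ₗ[ℂ] Y) (g : B →ₗ[ℂ] Y) : A ⊗[ℂ] B →ₗ[ℂ] Y :=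
  TensorProduct.lift ((LinearMap.mul ℂ Y).compl₁₂ f g)

@[simp]
lemma tensorMul_tmul {A B Y : Type*} [AddCommGroup A] [Module ℂ A] [AddCommGroup B] [Module ℂ B]
    [Ring Y] [Algebra ℂ Y] (f : A →ₗ[ℂ] Y) (g : B →ₗ[ℂ] Y) (a : A) (b : B) :
    tensorMul f g (a ⊗ₜ b) = f a * g b := by
  simp [tensorMul]

section CFC

variable {B : Type*} [NonUnitalCStarAlgebra B]

/-- The element `∑ b, b⋆ b` over a list. -/
def sumStarMul (β : List B) : B := (β.map fun b => star b * b).sum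

lemma re_inner_sumStarMul {K : Type*} [NormedAddCommGroup K] [InnerProductSpace ℂ K]
    [CompleteSpace K] (R : B →⋆ₙₐ[ℂ] (K →L[ℂ] K)) (β : List B) (h : K) :
    (inner ℂ (R (sumStarMul β) h) h).re = (β.map fun b => ‖R b h‖ ^ 2).sum := by
  induction β with
  | nil => simp [sumStarMul]
  | cons b β ih =>
    have h1 : sumStarMul (b :: β) = star b * b + sumStarMul β := by simp [sumStarMul]
    have h2 : (inner ℂ ((star (R b)) (R b h)) h).re = ‖R b h‖ ^ 2 := by
      rw [ContinuousLinearMap.star_eq_adjoint, ContinuousLinearMap.adjoint_inner_left,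
        inner_self_eq_norm_sq_to_K]
      norm_cast
    rw [h1, map_add, map_mul, map_star, _root_.add_apply, inner_add_left, Complex.add_re,
      mul_apply_eq_comp, h2, ih]
    simp

lemma exists_sqrt_factor (β : List B) {ε : ℝ} (hε : 0 < ε) :
    ∃ w r : B, star w = w ∧ star r = r ∧ w * r = r * w ∧ r * r = sumStarMul β ∧
      ‖w * sumStarMul β * w‖ ≤ 1 ∧
      ‖sumStarMul β - w * r * sumStarMul β - sumStarMul β * (w * r)
        + w * r * sumStarMul β * (w * r)‖ ≤ ε := by
  let _ := CStarAlgebra.spectralOrder B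
  have := CStarAlgebra.spectralOrderedRing B
  set b := sumStarMul β with hb
  have hb0 : 0 ≤ b := by
    refine List.sum_nonneg fun x hx => ?_
    obtain ⟨y, -, rfl⟩ := List.mem_map.1 hx
    exact star_mul_self_nonneg y
  have hsa : IsSelfAdjoint b := hb0.isSelfAdjoint
  have hq : ∀ t ∈ quasispectrum ℝ b, 0 ≤ t := quasispectrum_nonneg_of_nonneg b hb0
  have hne : ∀ t ∈ quasispectrum ℝ b, t + ε ≠ 0 := fun t ht => by have := hq t ht; positivity
  have hcw : ContinuousOn (fun t : ℝ => √t / (t + ε)) (quasispectrum ℝ b) :=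
    ContinuousOn.div (by fun_prop) (by fun_prop) hne
  have hcr : ContinuousOn (fun t : ℝ => √t) (quasispectrum ℝ b) := by fun_prop
  have hct : ContinuousOn (fun t : ℝ => t) (quasispectrum ℝ b) := by fun_prop
  have hcwr : ContinuousOn (fun t : ℝ => √t / (t + ε) * √t) (quasispectrum ℝ b) := hcw.mul hcr
  have hcwt : ContinuousOn (fun t : ℝ => √t / (t + ε) * t) (quasispectrum ℝ b) := hcw.mul hct
  have hc₁ : ContinuousOn (fun t : ℝ => √t / (t + ε) * √t * t) (quasispectrum ℝ b) :=
    hcwr.mul hct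
  have hc₂ : ContinuousOn (fun t : ℝ => t * (√t / (t + ε) * √t)) (quasispectrum ℝ b) :=
    hct.mul hcwr
  have hc₃ : ContinuousOn (fun t : ℝ => √t / (t + ε) * √t * t * (√t / (t + ε) * √t))
    (quasispectrum ℝ b) := hc₁.mul hcwr
  have hc₄ : ContinuousOn (fun t : ℝ => t - √t / (t + ε) * √t * t) (quasispectrum ℝ b) :=
    hct.sub hc₁
  have hc₅ : ContinuousOn (fun t : ℝ => t - √t / (t + ε) * √t * t - t * (√t / (t + ε) * √t))
    (quasispectrum ℝ b) := hc₄.sub hc₂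
  let w := cfcₙ (fun t : ℝ => √t / (t + ε)) b
  let r := cfcₙ (fun t : ℝ => √t) b
  have hid : cfcₙ (fun t : ℝ => t) b = b := cfcₙ_id' ℝ b
  have hwr : w * r = cfcₙ (fun t : ℝ => √t / (t + ε) * √t) b :=
    (cfcₙ_mul _ _ b hcw (by simp) hcr (by simp)).symm
  have hb1 : w * r * b = cfcₙ (fun t : ℝ => √t / (t + ε) * √t * t) b := by
    rw [hwr, cfcₙ_mul _ _ b hcwr (by simp) hct rfl, hid]
  have hb2 : b * (w * r) = cfcₙ (fun t : ℝ => t * (√t / (t + ε) * √t)) b := by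
    rw [hwr, cfcₙ_mul _ _ b hct rfl hcwr (by simp), hid]
  have hb3 : w * r * b * (w * r)
      = cfcₙ (fun t : ℝ => √t / (t + ε) * √t * t * (√t / (t + ε) * √t)) b := by
    rw [hb1, hwr, cfcₙ_mul _ _ b hc₁ (by simp) hcwr (by simp)]
  refine ⟨w, r, IsSelfAdjoint.cfcₙ, IsSelfAdjoint.cfcₙ, (cfcₙ_commute_cfcₙ _ _ b).eq, ?_, ?_, ?_⟩
  · rw [← cfcₙ_mul _ _ b hcr (by simp) hcr (by simp)]
    conv_rhs => rw [← hid]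
    exact cfcₙ_congr fun t ht => Real.mul_self_sqrt (hq t ht)
  · have : w * b * w = cfcₙ (fun t : ℝ => √t / (t + ε) * t * (√t / (t + ε))) b := by
      rw [cfcₙ_mul _ _ b hcwt (by simp) hcw (by simp),
        cfcₙ_mul _ _ b hcw (by simp) hct rfl, hid]
    rw [this]
    refine norm_cfcₙ_le fun t ht => ?_
    have ht0 := hq t ht
    have h1 : √t / (t + ε) * t * (√t / (t + ε)) = (t / (t + ε)) ^ 2 := by
      have := Real.mul_self_sqrt ht0
      rw [div_mul_eq_mul_div, div_mul_div_comm, mul_right_comm, this, div_pow, sq, sq]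
    rw [h1, Real.norm_eq_abs, abs_of_nonneg (by positivity)]
    exact pow_le_one₀ (by positivity) (div_le_one_of_le₀ (by linarith) (by positivity))
  · have : b - w * r * b - b * (w * r) + w * r * b * (w * r) = cfcₙ (fun t : ℝ =>
        t - √t / (t + ε) * √t * t - t * (√t / (t + ε) * √t)
          + √t / (t + ε) * √t * t * (√t / (t + ε) * √t)) b := by
      rw [cfcₙ_add _ _ b hc₅ (by simp) hc₃ (by simp), cfcₙ_sub _ _ b hc₄ (by simp) hc₂ (by simp),
        cfcₙ_sub _ _ b hct rfl hc₁ (by simp), hid, hb3, hb1, hb2]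
    rw [this]
    refine norm_cfcₙ_le fun t ht => ?_
    have ht0 := hq t ht
    have hs : √t / (t + ε) * √t = t / (t + ε) := by
      rw [div_mul_eq_mul_div, Real.mul_self_sqrt ht0]
    have h1 : t - t / (t + ε) * t - t * (t / (t + ε)) + t / (t + ε) * t * (t / (t + ε))
        = t * ε ^ 2 / (t + ε) ^ 2 := by
      have := hne t ht
      field_simp
      ring
    rw [hs, h1, Real.norm_eq_abs, abs_of_nonneg (by positivity), div_le_iff₀ (by positivity)]
    nlinarith [mul_nonneg hε.le (mul_nonneg ht0 ht0), mul_nonneg (mul_nonneg hε.le hε.le) ht0,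
      pow_pos hε 3]

end CFC

variable {A : Type u} [CStarAlgebra A] {B : Type v} [NonUnitalCStarAlgebra B]

/-- The action of the algebraic tensor product on the space of a commuting pair. -/
def CommutingPair.eval (p : CommutingPair A B) : A ⊗[ℂ] B →ₗ[ℂ] (p.space →L[ℂ] p.space) :=
  tensorMul (p.left : A →ₗ[ℂ] (p.space →L[ℂ] p.space)) (p.right : B →ₗ[ℂ] (p.space →L[ℂ] p.space))

@[simp]
lemma CommutingPair.eval_tmul (p : CommutingPair A B) (a : A) (b : B) :
    p.eval (a ⊗ₜ b) = p.left a * p.right b := by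
  simp [CommutingPair.eval]

/-- Left multiplication by `a ⊗ 1`. -/
def tensorLeft (B : Type v) [NonUnitalCStarAlgebra B] (a : A) : A ⊗[ℂ] B →ₗ[ℂ] A ⊗[ℂ] B :=
  LinearMap.rTensor B (LinearMap.mulLeft ℂ a)

/-- Left multiplication by `1 ⊗ b`. -/
def tensorRight (A : Type u) [CStarAlgebra A] (b : B) : A ⊗[ℂ] B →ₗ[ℂ] A ⊗[ℂ] B :=
  LinearMap.lTensor A (LinearMap.mulLeft ℂ b)

/-- Right multiplication by `1 ⊗ b`. -/
def tensorMulRight (A : Type u) [CStarAlgebra A] (b : B) : A ⊗[ℂ] B →ₗ[ℂ] A ⊗[ℂ] B :=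
  LinearMap.lTensor A (LinearMap.mulRight ℂ b)

lemma CommutingPair.eval_tensorLeft (p : CommutingPair A B) (a : A) (x : A ⊗[ℂ] B) :
    p.eval (tensorLeft B a x) = p.left a * p.eval x := by
  induction x with
  | zero => simp
  | add x y hx hy => simp [hx, hy, mul_add]
  | tmul c b => simp [tensorLeft, mul_assoc]

lemma CommutingPair.eval_tensorRight (p : CommutingPair A B) (b : B) (x : A ⊗[ℂ] B) :
    p.eval (tensorRight A b x) = p.right b * p.eval x := by
  induction x with
  | zero => simp
  | add x y hx hy => simp [hx, hy, mul_add]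
  | tmul a c =>
    have := (p.commute a b).eq
    simp only [tensorRight, LinearMap.lTensor_tmul, LinearMap.mulLeft_apply, eval_tmul, map_mul]
    rw [← mul_assoc, ← mul_assoc, this]

lemma CommutingPair.eval_tensorMulRight (p : CommutingPair A B) (b : B) (x : A ⊗[ℂ] B) :
    p.eval (tensorMulRight A b x) = p.eval x * p.right b := by
  induction x with
  | zero => simp
  | add x y hx hy => simp [hx, hy, add_mul]
  | tmul a c => simp [tensorMulRight, mul_assoc]

/-- The positive functions `(p, h) ↦ ∑ b, ‖p.right b h‖²`. -/
def quadSum (β : List B) (z : Σ p : CommutingPair A B, p.space) : ℝ :=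
  (β.map fun b => ‖z.1.right b z.2‖ ^ 2).sum

variable {H : Type*} [NormedAddCommGroup H] [InnerProductSpace ℂ H] [CompleteSpace H]

/-- A vector bound for a map on `A ⊗ B` which is bounded for the maximal norm. -/
lemma norm_apply_sq_le_of_le_quadSum (T : A ⊗[ℂ] B →ₗ[ℂ] (H →L[ℂ] H))
    (τ : B →⋆ₙₐ[ℂ] (H →L[ℂ] H)) (hTτ : ∀ x b, T (tensorMulRight A b x) = T x * τ b)
    {C : ℝ} (hC : 0 ≤ C)
    (hT : ∀ x r, 0 ≤ r → (∀ p : CommutingPair A B, ‖p.eval x‖ ≤ r) → ‖T x‖ ≤ C * r)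
    (x : A ⊗[ℂ] B) (β : List B) (hx : ∀ z : Σ p : CommutingPair A B, p.space,
      ‖z.1.eval x z.2‖ ^ 2 ≤ quadSum β z) (ξ : H) :
    ‖T x ξ‖ ^ 2 ≤ C ^ 2 * (β.map fun b => ‖τ b ξ‖ ^ 2).sum := by
  set Q := (β.map fun b => ‖τ b ξ‖ ^ 2).sum with hQ
  have hQ0 : 0 ≤ Q := by
    refine List.sum_nonneg fun x hx => ?_
    obtain ⟨y, -, rfl⟩ := List.mem_map.1 hx
    positivity
  have hx' (p : CommutingPair A B) (h : p.space) :
      ‖p.eval x h‖ ^ 2 ≤ (inner ℂ (p.right (sumStarMul β) h) h).re := by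
    rw [re_inner_sumStarMul]
    exact hx ⟨p, h⟩
  -- a bound for the form of an element of norm at most `r`
  have hform (p : CommutingPair A B) (c : B) (r : ℝ) (hc : ‖c‖ ≤ r) (h : p.space) :
      (inner ℂ (p.right c h) h).re ≤ r * ‖h‖ ^ 2 := by
    have h1 : ‖p.right c h‖ ≤ r * ‖h‖ := (ContinuousLinearMap.le_opNorm _ _).trans <|
      mul_le_mul_of_nonneg_right ((NonUnitalStarAlgHom.norm_apply_le p.right c).trans hc)
        (norm_nonneg _)
    have h2 := re_inner_le_norm (𝕜 := ℂ) (p.right c h) h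
    simp only [RCLike.re_eq_complex_re] at h2
    nlinarith [norm_nonneg h]
  have key : ‖T x ξ‖ ≤ C * √Q := by
    refine le_of_forall_pos_le_add fun δ hδ => ?_
    set e := δ / (C * ‖ξ‖ + 1) with he
    have hden : 0 < C * ‖ξ‖ + 1 := by positivity
    have he0 : 0 < e := by positivity
    obtain ⟨w, r, hw, hr, hwr, hrr, h1, h2⟩ := exists_sqrt_factor β (pow_pos he0 2)
    have hrξ : ‖τ r ξ‖ = √Q := by
      have : ‖τ r ξ‖ ^ 2 = Q := by
        have h3 := re_inner_sumStarMul τ [r] ξ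
        have h4 := re_inner_sumStarMul τ β ξ
        rw [← hrr] at h4
        simp only [sumStarMul, List.map_cons, List.map_nil, List.sum_cons, List.sum_nil, add_zero,
          hr] at h3
        rw [← h3, h4]
      rw [← this, Real.sqrt_sq (norm_nonneg _)]
    have hb1 : ‖T (tensorMulRight A w x)‖ ≤ C * 1 := by
      refine hT _ _ zero_le_one fun p => ContinuousLinearMap.opNorm_le_bound _ zero_le_one
        fun h => ?_
      rw [p.eval_tensorMulRight, mul_apply_eq_comp, one_mul]
      refine le_of_sq_le_sq ?_ (norm_nonneg _)
      refine (hx' p _).trans ?_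
      have := hform p _ _ h1 h
      rw [one_mul] at this
      refine le_trans (le_of_eq ?_) this
      rw [map_mul, map_mul, mul_apply_eq_comp, mul_apply_eq_comp]
      have hR : p.right w = star (p.right w) := by rw [← map_star, hw]
      have hadj (y z : p.space) : inner ℂ (p.right w y) z = inner ℂ y (p.right w z) := by
        rw [← ContinuousLinearMap.adjoint_inner_left, ← ContinuousLinearMap.star_eq_adjoint, ← hR]
      rw [hadj]
    have hb2 : ‖T (x - tensorMulRight A (w * r) x)‖ ≤ C * e := by
      refine hT _ _ he0.le fun p => ContinuousLinearMap.opNorm_le_bound _ he0.le fun h => ?_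
      rw [map_sub, p.eval_tensorMulRight, _root_.sub_apply, mul_apply_eq_comp, ← map_sub]
      refine le_of_sq_le_sq ?_ (by positivity)
      refine (hx' p _).trans ?_
      have := hform p _ _ h2 h
      rw [mul_pow]
      refine le_trans (le_of_eq ?_) this
      have hsa : star (w * r) = w * r := by rw [star_mul, hw, hr, hwr]
      set c := w * r
      have hadj (y z : p.space) : inner ℂ (p.right c y) z = inner ℂ y (p.right c z) := by
        conv_rhs => rw [← hsa, map_star, ContinuousLinearMap.star_eq_adjoint,
          ContinuousLinearMap.adjoint_inner_right]
      simp only [map_add, map_sub, map_mul, _root_.add_apply, _root_.sub_apply,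
        mul_apply_eq_comp, inner_add_left, inner_sub_left, inner_sub_right, hadj]
      congr 1
      ring
    have hdec : T x ξ = T (x - tensorMulRight A (w * r) x) ξ
        + T (tensorMulRight A w x) (τ r ξ) := by
      have : T (tensorMulRight A (w * r) x) ξ = T (tensorMulRight A w x) (τ r ξ) := by
        rw [hTτ, hTτ, map_mul]; rfl
      rw [map_sub, _root_.sub_apply, this]; abel
    rw [hdec, add_comm]
    refine (norm_add_le _ _).trans (add_le_add ?_ ?_)
    · refine (ContinuousLinearMap.le_of_opNorm_le _ hb1 _).trans ?_
      rw [hrξ, mul_one]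
    · refine (ContinuousLinearMap.le_of_opNorm_le _ hb2 _).trans ?_
      rw [he, mul_right_comm, ← mul_div_assoc, div_le_iff₀ hden]
      nlinarith [norm_nonneg ξ]
  calc ‖T x ξ‖ ^ 2 ≤ (C * √Q) ^ 2 := pow_le_pow_left₀ (norm_nonneg _) key 2
    _ = C ^ 2 * Q := by rw [mul_pow, Real.sq_sqrt hQ0]

end Domination

section Functional

open scoped TensorProduct

/-- A Hahn-Banach theorem: a convex cone of constraints `s f ≤ r` has a linear solution `s` as soon
as it contains no contradictory constraint `0 ≤ r < 0`. -/
lemma exists_linearMap_le_of_cone {V : Type*} [AddCommGroup V] [Module ℝ V] (K : Set (V × ℝ))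
    (hadd : ∀ x ∈ K, ∀ y ∈ K, x + y ∈ K) (hsmul : ∀ c : ℝ, 0 < c → ∀ x ∈ K, c • x ∈ K)
    (hzero : ∀ r : ℝ, ((0 : V), r) ∈ K → 0 ≤ r) (hdom : ∀ f : V, ∃ r, (f, r) ∈ K) :
    ∃ s : V →ₗ[ℝ] ℝ, ∀ f r, (f, r) ∈ K → s f ≤ r := by
  let N : V → ℝ := fun f => sInf {r | (f, r) ∈ K}
  have hbdd (f : V) : BddBelow {r | (f, r) ∈ K} := by
    obtain ⟨t, ht⟩ := hdom (-f)
    refine ⟨-t, fun r hr => ?_⟩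
    have := hzero (r + t) (by simpa using hadd _ hr _ ht)
    linarith
  have hN (f : V) (r : ℝ) (h : (f, r) ∈ K) : N f ≤ r := csInf_le (hbdd f) h
  have hle (c : ℝ) (hc : 0 < c) (f : V) : N (c • f) ≤ c * N f := by
    rw [← div_le_iff₀' hc]
    refine le_csInf (hdom f) fun r hr => ?_
    rw [div_le_iff₀' hc]
    exact hN _ _ (hsmul c hc _ hr)
  obtain ⟨s, -, hs⟩ := exists_extension_of_le_sublinear (⊥ : V →ₗ.[ℝ] ℝ) N
    (fun c hc f => by
      refine le_antisymm (hle c hc f) ?_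
      have := hle c⁻¹ (inv_pos.2 hc) (c • f)
      rw [inv_smul_smul₀ hc.ne'] at this
      rwa [← div_eq_inv_mul, le_div_iff₀' hc] at this)
    (fun f g => by
      refine le_of_forall_pos_lt_add fun ε hε => ?_
      obtain ⟨r, hr, hr'⟩ := exists_lt_of_csInf_lt (hdom f) (lt_add_of_pos_right (N f) (half_pos hε))
      obtain ⟨t, ht, ht'⟩ := exists_lt_of_csInf_lt (hdom g) (lt_add_of_pos_right (N g) (half_pos hε))
      have := hN (f + g) (r + t) (hadd _ hr _ ht)
      linarith)
    (fun x => by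
      have hx : (x : V) = 0 := (Submodule.mem_bot ℝ).1 x.2
      have h0 : (⊥ : V →ₗ.[ℝ] ℝ) x = 0 := by
        have : x = 0 := Subtype.ext hx
        rw [this]; exact map_zero _
      rw [h0, hx]
      exact le_csInf (hdom 0) hzero)
  exact ⟨s, fun f r h => (hs f).trans (hN f r h)⟩

variable {A : Type u} [CStarAlgebra A] {B : Type v} [NonUnitalCStarAlgebra B]

lemma quadSum_append (β γ : List B) (z : Σ p : CommutingPair A B, p.space) :
    quadSum (β ++ γ) z = quadSum β z + quadSum γ z := by
  simp [quadSum]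

lemma sum_map_norm_sq_smul {V W : Type*} [AddCommGroup V] [Module ℂ V] [SeminormedAddCommGroup W]
    [NormedSpace ℂ W] (f : V →ₗ[ℂ] W) (l : List V) {c : ℝ} (hc : 0 ≤ c) :
    ((l.map fun b => ((√c : ℝ) : ℂ) • b).map fun b => ‖f b‖ ^ 2).sum
      = c * (l.map fun b => ‖f b‖ ^ 2).sum := by
  rw [List.map_map, ← List.sum_map_mul_left]
  congr 2
  ext b
  simp [norm_smul, mul_pow, Real.sq_sqrt hc, abs_of_nonneg (Real.sqrt_nonneg c)]

/-- The linear map `x ↦ x h` for a point `h` of the space of a commuting pair. -/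
def evalAt (z : Σ p : CommutingPair A B, p.space) : A ⊗[ℂ] B →ₗ[ℂ] z.1.space :=
  (ContinuousLinearMap.apply ℂ z.1.space z.2).toLinearMap ∘ₗ z.1.eval

lemma evalAt_apply (z : Σ p : CommutingPair A B, p.space) (x : A ⊗[ℂ] B) :
    evalAt z x = z.1.eval x z.2 := rfl

lemma quadSum_smul (β : List B) {c : ℝ} (hc : 0 ≤ c) (z : Σ p : CommutingPair A B, p.space) :
    quadSum (β.map fun b => ((√c : ℝ) : ℂ) • b) z = c * quadSum β z :=
  sum_map_norm_sq_smul ((ContinuousLinearMap.apply ℂ z.1.space z.2).toLinearMap ∘ₗ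
    (z.1.right : B →ₗ[ℂ] (z.1.space →L[ℂ] z.1.space))) β hc

variable (A B) in
/-- The functions on the points of all commuting pairs which are dominated by a finite sum
`∑ b, ‖p.right b h‖²`. -/
def dominatedFunctions : Submodule ℝ ((Σ p : CommutingPair A B, p.space) → ℝ) where
  carrier := {f | ∃ β : List B, ∀ z, |f z| ≤ quadSum β z}
  add_mem' := by
    rintro f g ⟨β, hβ⟩ ⟨γ, hγ⟩
    refine ⟨β ++ γ, fun z => ?_⟩
    rw [quadSum_append]
    exact (abs_add_le _ _).trans (add_le_add (hβ z) (hγ z))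
  zero_mem' := ⟨[], fun z => by simp [quadSum]⟩
  smul_mem' := by
    rintro c f ⟨β, hβ⟩
    refine ⟨β.map fun b => ((√|c| : ℝ) : ℂ) • b, fun z => ?_⟩
    rw [quadSum_smul _ (abs_nonneg c), Pi.smul_apply, smul_eq_mul, abs_mul]
    exact mul_le_mul_of_nonneg_left (hβ z) (abs_nonneg c)

lemma exists_evalAt_le_quadSum (x : A ⊗[ℂ] B) :
    ∃ β : List B, ∀ z : Σ p : CommutingPair A B, p.space, ‖evalAt z x‖ ^ 2 ≤ quadSum β z := by
  induction x with
  | zero => exact ⟨[], fun z => by simp [quadSum]⟩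
  | add x y hx hy =>
    obtain ⟨β, hβ⟩ := hx
    obtain ⟨γ, hγ⟩ := hy
    refine ⟨((β ++ γ).map fun b => ((√2 : ℝ) : ℂ) • b), fun z => ?_⟩
    rw [quadSum_smul _ zero_le_two, quadSum_append, map_add]
    have h1 := norm_add_le (evalAt z x) (evalAt z y)
    have := hβ z
    have := hγ z
    nlinarith [sq_nonneg (‖evalAt z x‖ - ‖evalAt z y‖), norm_nonneg (evalAt z x + evalAt z y)]
  | tmul a b =>
    refine ⟨[((‖a‖ : ℝ) : ℂ) • b], fun z => ?_⟩
    have h1 : evalAt z (a ⊗ₜ[ℂ] b) = z.1.left a (z.1.right b z.2) := by simp [evalAt_apply]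
    have h2 : ‖z.1.left a (z.1.right b z.2)‖ ≤ ‖a‖ * ‖z.1.right b z.2‖ :=
      ContinuousLinearMap.le_of_opNorm_le _ (NonUnitalStarAlgHom.norm_apply_le z.1.left a) _
    have h3 : quadSum [((‖a‖ : ℝ) : ℂ) • b] z = (‖a‖ * ‖z.1.right b z.2‖) ^ 2 := by
      simp only [quadSum, List.map_cons, List.map_nil, List.sum_cons, List.sum_nil, add_zero]
      rw [map_smul, _root_.smul_apply, norm_smul]
      simp
    rw [h1, h3]
    exact pow_le_pow_left₀ (norm_nonneg _) h2 2

lemma re_inner_evalAt_mem (x y : A ⊗[ℂ] B) :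
    (fun z => (inner ℂ (evalAt z x) (evalAt z y)).re) ∈ dominatedFunctions A B := by
  obtain ⟨β, hβ⟩ := exists_evalAt_le_quadSum x
  obtain ⟨γ, hγ⟩ := exists_evalAt_le_quadSum y
  refine ⟨β ++ γ, fun z => ?_⟩
  rw [quadSum_append]
  have h1 := (Complex.abs_re_le_norm (inner ℂ (evalAt z x) (evalAt z y))).trans
    (norm_inner_le_norm _ _)
  nlinarith [hβ z, hγ z, sq_nonneg (‖evalAt z x‖ - ‖evalAt z y‖), sq_nonneg ‖evalAt z x‖,
    sq_nonneg ‖evalAt z y‖]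

variable {H : Type*} [NormedAddCommGroup H] [InnerProductSpace ℂ H] [CompleteSpace H]

/-- Rows over `B` which are contractive in all representations, and which are nearly isometric on
prescribed finite families of vectors. -/
def HasContractiveRows (A : Type u) [CStarAlgebra A] (τ : B →⋆ₙₐ[ℂ] (H →L[ℂ] H)) : Prop :=
  ∀ (n : ℕ) (η : Fin n → H) (ε : ℝ), 0 < ε → ∃ c : Fin n → B,
    (∀ (p : CommutingPair A B) (w : Fin n → p.space),
      ‖∑ k, p.right (c k) (w k)‖ ^ 2 ≤ ∑ k, ‖w k‖ ^ 2) ∧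
    √(∑ k, ‖η k‖ ^ 2) ≤ ‖∑ k, τ (c k) (η k)‖ + ε

lemma sum_norm_apply_sq_le_of_le_quadSum (T : A ⊗[ℂ] B →ₗ[ℂ] (H →L[ℂ] H))
    (τ : B →⋆ₙₐ[ℂ] (H →L[ℂ] H)) (hτ : HasContractiveRows A τ)
    (hTr : ∀ x b, T (tensorMulRight A b x) = T x * τ b)
    (hTl : ∀ x b, T (tensorRight A b x) = τ b * T x)
    {C : ℝ} (hC : 0 ≤ C)
    (hT : ∀ x r, 0 ≤ r → (∀ p : CommutingPair A B, ‖p.eval x‖ ≤ r) → ‖T x‖ ≤ C * r)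
    (xs : List (A ⊗[ℂ] B)) (β : List B) (hx : ∀ z : Σ p : CommutingPair A B, p.space,
      (xs.map fun x => ‖evalAt z x‖ ^ 2).sum ≤ quadSum β z) (ξ : H) :
    (xs.map fun x => ‖T x ξ‖ ^ 2).sum ≤ C ^ 2 * (β.map fun b => ‖τ b ξ‖ ^ 2).sum := by
  set Q := (β.map fun b => ‖τ b ξ‖ ^ 2).sum with hQ
  have hQ0 : 0 ≤ Q := by
    refine List.sum_nonneg fun x hx => ?_
    obtain ⟨y, -, rfl⟩ := List.mem_map.1 hx
    positivity
  have hsum (f : A ⊗[ℂ] B → ℝ) : (xs.map f).sum = ∑ k : Fin xs.length, f xs[k] :=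
    (Fin.sum_univ_fun_getElem xs f).symm
  rw [hsum]
  set S := ∑ k : Fin xs.length, ‖T xs[k] ξ‖ ^ 2 with hS
  have hS0 : 0 ≤ S := Finset.sum_nonneg fun _ _ => by positivity
  have key : √S ≤ C * √Q := by
    refine le_of_forall_pos_le_add fun ε hε => ?_
    obtain ⟨c, hc1, hc2⟩ := hτ xs.length (fun k => T xs[k] ξ) ε hε
    refine hc2.trans (add_le_add_left ?_ ε)
    have h1 : ∑ k, τ (c k) (T xs[k] ξ) = T (∑ k, tensorRight A (c k) xs[k]) ξ := by
      simp [hTl, map_sum]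
    rw [h1]
    have h2 := norm_apply_sq_le_of_le_quadSum T τ hTr hC hT (∑ k, tensorRight A (c k) xs[k]) β
      (fun z => by
        refine le_trans ?_ ((hsum _).symm.le.trans (hx z))
        have := hc1 z.1 (fun k => evalAt z xs[k])
        refine le_trans (le_of_eq ?_) this
        simp [map_sum, CommutingPair.eval_tensorRight, evalAt_apply]) ξ
    refine le_of_sq_le_sq ?_ (by positivity)
    rwa [mul_pow, Real.sq_sqrt hQ0]
  calc S = √S ^ 2 := (Real.sq_sqrt hS0).symm
    _ ≤ (C * √Q) ^ 2 := pow_le_pow_left₀ (Real.sqrt_nonneg _) key 2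
    _ = C ^ 2 * Q := by rw [mul_pow, Real.sq_sqrt hQ0]

/-- The functional whose GNS space carries the similarity. -/
theorem exists_dominating_functional (T : A ⊗[ℂ] B →ₗ[ℂ] (H →L[ℂ] H))
    (τ : B →⋆ₙₐ[ℂ] (H →L[ℂ] H)) (hτ : HasContractiveRows A τ)
    (hTr : ∀ x b, T (tensorMulRight A b x) = T x * τ b)
    (hTl : ∀ x b, T (tensorRight A b x) = τ b * T x)
    {C : ℝ} (hC : 0 ≤ C)
    (hT : ∀ x r, 0 ≤ r → (∀ p : CommutingPair A B, ‖p.eval x‖ ≤ r) → ‖T x‖ ≤ C * r) (ξ : H) :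
    ∃ s : dominatedFunctions A B →ₗ[ℝ] ℝ,
      (∀ (f : dominatedFunctions A B) (β : List B), (∀ z, f.1 z ≤ quadSum β z) →
        s f ≤ C ^ 2 * (β.map fun b => ‖τ b ξ‖ ^ 2).sum) ∧
      ∀ (x : A ⊗[ℂ] B) (f : dominatedFunctions A B), (∀ z, f.1 z = ‖evalAt z x‖ ^ 2) →
        ‖T x ξ‖ ^ 2 ≤ s f := by
  let K : Set (dominatedFunctions A B × ℝ) := {q | ∃ (xs : List (A ⊗[ℂ] B)) (β : List B),
    (∀ z, q.1.1 z + (xs.map fun x => ‖evalAt z x‖ ^ 2).sum ≤ quadSum β z) ∧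
    C ^ 2 * (β.map fun b => ‖τ b ξ‖ ^ 2).sum - (xs.map fun x => ‖T x ξ‖ ^ 2).sum ≤ q.2}
  suffices h : ∃ s : dominatedFunctions A B →ₗ[ℝ] ℝ, ∀ f r, (f, r) ∈ K → s f ≤ r by
    obtain ⟨s, hs⟩ := h
    refine ⟨s, fun f β hf => hs _ _ ⟨[], β, by simpa using hf, by simp⟩, fun x f hf => ?_⟩
    have := hs (-f) (-‖T x ξ‖ ^ 2) ⟨[x], [], fun z => by simp [hf, quadSum], by simp⟩
    rw [map_neg] at this
    linarith
  refine exists_linearMap_le_of_cone K ?_ ?_ ?_ ?_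
  · rintro ⟨f, r⟩ ⟨xs, β, h1, h2⟩ ⟨g, t⟩ ⟨ys, γ, h3, h4⟩
    refine ⟨xs ++ ys, β ++ γ, fun z => ?_, ?_⟩
    · have := h1 z
      have := h3 z
      simp only [quadSum_append, List.map_append, List.sum_append, Prod.fst_add,
        Submodule.coe_add, Pi.add_apply] at *
      linarith
    · simp only [List.map_append, List.sum_append, Prod.snd_add] at *
      linarith
  · rintro c hc ⟨f, r⟩ ⟨xs, β, h1, h2⟩
    refine ⟨xs.map fun b => ((√c : ℝ) : ℂ) • b, β.map fun b => ((√c : ℝ) : ℂ) • b,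
      fun z => ?_, ?_⟩
    · rw [quadSum_smul _ hc.le, sum_map_norm_sq_smul (evalAt z) _ hc.le]
      have := mul_le_mul_of_nonneg_left (h1 z) hc.le
      simp only [Prod.smul_fst, Submodule.coe_smul, Pi.smul_apply, smul_eq_mul] at *
      linarith
    · have e1 := sum_map_norm_sq_smul ((ContinuousLinearMap.apply ℂ H ξ).toLinearMap ∘ₗ
        (τ : B →ₗ[ℂ] (H →L[ℂ] H))) β hc.le
      have e2 := sum_map_norm_sq_smul ((ContinuousLinearMap.apply ℂ H ξ).toLinearMap ∘ₗ T) xs hc.le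
      have := mul_le_mul_of_nonneg_left h2 hc.le
      simp only [LinearMap.comp_apply, ContinuousLinearMap.coe_coe,
        ContinuousLinearMap.apply_apply, LinearMap.coe_coe, Prod.smul_snd, smul_eq_mul] at *
      rw [e1, e2]
      linarith
  · rintro r ⟨xs, β, h1, h2⟩
    have := sum_norm_apply_sq_le_of_le_quadSum T τ hτ hTr hTl hC hT xs β
      (fun z => by simpa using h1 z) ξ
    simp only at h2
    linarith
  · rintro ⟨f, β, hf⟩
    exact ⟨_, [], β, fun z => by simpa using (le_abs_self _).trans (hf z), le_rfl⟩

end Functional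

section GNS

open UniformSpace

/-- The positive operator `S S⋆` obtained from a map `t : X → H` on a pre-Hilbert space, extended
to a bounded operator `S` on the completion, together with its intertwining properties. -/
theorem exists_gramOperator {X : Type*} [AddCommGroup X] [Module ℂ X]
    (c : PreInnerProductSpace.Core ℂ X) {H : Type*} [NormedAddCommGroup H]
    [InnerProductSpace ℂ H] [CompleteSpace H] (t : X →ₗ[ℂ] H)
    (ht : ∀ x, ‖t x‖ ^ 2 ≤ (c.inner x x).re) :
    ∃ q : H →L[ℂ] H, star q = q ∧ (∀ g, 0 ≤ (inner ℂ (q g) g).re) ∧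
      (∀ x g, ‖inner ℂ (t x) g‖ ^ 2 ≤ (c.inner x x).re * (inner ℂ (q g) g).re) ∧
      ∀ (l l' : X →ₗ[ℂ] X) (w w' : H →L[ℂ] H) (r : ℝ), (∀ x, t (l x) = w (t x)) →
        (∀ x, t (l' x) = w' (t x)) → (∀ x y, c.inner (l x) y = c.inner x (l' y)) →
        (∀ x, (c.inner (l x) (l x)).re ≤ r ^ 2 * (c.inner x x).re) →
        (∀ x, (c.inner (l' x) (l' x)).re ≤ r ^ 2 * (c.inner x x).re) →
        star (w * q) = w' * q := by
  let _ : SeminormedAddCommGroup X := InnerProductSpace.Core.toSeminormedAddCommGroup (c := c)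
  let _ : InnerProductSpace ℂ X := InnerProductSpace.ofCore c
  have hin (x y : X) : inner ℂ x y = c.inner x y := rfl
  have hnorm (x : X) : ‖x‖ ^ 2 = (c.inner x x).re := by
    rw [← hin]; exact (inner_self_eq_norm_sq (𝕜 := ℂ) x).symm
  let tc : X →L[ℂ] H := t.mkContinuous 1 fun x => by
    rw [one_mul]
    exact le_of_sq_le_sq ((ht x).trans (hnorm x).ge) (norm_nonneg _)
  let S : Completion X →L[ℂ] H := tc.extend (Completion.toComplL (𝕜 := ℂ))
  have hS (x : X) : S (x : Completion X) = t x :=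
    tc.extend_eq Completion.denseRange_coe (Completion.isUniformInducing_coe X) x
  let Sd : H →L[ℂ] Completion X := ContinuousLinearMap.adjoint S
  have hSd (x : Completion X) (g : H) : inner ℂ x (Sd g) = inner ℂ (S x) g :=
    ContinuousLinearMap.adjoint_inner_right S x g
  let q : H →L[ℂ] H := S ∘L Sd
  have hq : star q = q := by
    simp [q, Sd, ContinuousLinearMap.star_eq_adjoint, ContinuousLinearMap.adjoint_comp]
  have hqg (g : H) : (inner ℂ (q g) g).re = ‖Sd g‖ ^ 2 := by
    rw [show q g = S (Sd g) from rfl, ← hSd]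
    exact inner_self_eq_norm_sq (𝕜 := ℂ) _
  refine ⟨q, hq, fun g => by rw [hqg]; positivity, fun x g => ?_,
    fun l l' w w' r hl hl' hadj hr hr' => ?_⟩
  · rw [hqg, ← hnorm, ← mul_pow, ← hS, ← hSd, ← Completion.norm_coe x]
    exact pow_le_pow_left₀ (norm_nonneg _) (norm_inner_le_norm _ _) 2
  · have hbd (k : X →ₗ[ℂ] X) (hk : ∀ x, (c.inner (k x) (k x)).re ≤ r ^ 2 * (c.inner x x).re)
        (x : X) : ‖k x‖ ≤ |r| * ‖x‖ := by
      refine le_of_sq_le_sq ?_ (by positivity)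
      rw [mul_pow, sq_abs, hnorm, hnorm]
      exact hk x
    let lc : X →L[ℂ] X := l.mkContinuous |r| (hbd l hr)
    let lc' : X →L[ℂ] X := l'.mkContinuous |r| (hbd l' hr')
    have htwine (k : X →L[ℂ] X) (v : H →L[ℂ] H) (hk : ∀ x, t (k x) = v (t x)) :
        S ∘L k.completion = v ∘L S := by
      ext x
      induction x using Completion.induction_on with
      | hp => apply isClosed_eq <;> fun_prop
      | ih x => simp [hS, hk]
    have hadj' : lc'.completion = ContinuousLinearMap.adjoint lc.completion := by
      rw [ContinuousLinearMap.eq_adjoint_iff]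
      intro x y
      induction x, y using Completion.induction_on₂ with
      | hp => apply isClosed_eq <;> fun_prop
      | ih x y =>
        have h1 : inner ℂ (l' x) y = inner ℂ x (l y) := by
          rw [← inner_conj_symm, hin, ← hadj, ← hin, inner_conj_symm]
        simpa [lc, lc'] using h1
    have h1 : w * q = S ∘L lc.completion ∘L Sd := by
      rw [← ContinuousLinearMap.comp_assoc, htwine lc w hl]; rfl
    have h2 : w' * q = S ∘L lc'.completion ∘L Sd := by
      rw [← ContinuousLinearMap.comp_assoc, htwine lc' w' hl']; rfl
    rw [h1, h2, hadj']
    simp [ContinuousLinearMap.star_eq_adjoint, ContinuousLinearMap.adjoint_comp, Sd,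
      ContinuousLinearMap.comp_assoc]

end GNS

section FunctionalGNS

open scoped TensorProduct

variable {A : Type u} [CStarAlgebra A] {B : Type v} [NonUnitalCStarAlgebra B]

/-- The real part of the inner product defined by a functional on the dominated functions. -/
def reForm (s : dominatedFunctions A B →ₗ[ℝ] ℝ) (x y : A ⊗[ℂ] B) : ℝ :=
  s ⟨fun z => (inner ℂ (evalAt z x) (evalAt z y)).re, re_inner_evalAt_mem x y⟩

variable (s : dominatedFunctions A B →ₗ[ℝ] ℝ)

lemma reForm_congr {x y x' y' : A ⊗[ℂ] B}
    (h : ∀ z, (inner ℂ (evalAt z x) (evalAt z y)).re = (inner ℂ (evalAt z x') (evalAt z y')).re) :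
    reForm s x y = reForm s x' y' := by
  unfold reForm
  congr 2
  ext z
  exact h z

lemma reForm_comm (x y : A ⊗[ℂ] B) : reForm s x y = reForm s y x :=
  reForm_congr s fun _ => inner_re_symm (𝕜 := ℂ) _ _

lemma reForm_add_left (x y z : A ⊗[ℂ] B) :
    reForm s (x + y) z = reForm s x z + reForm s y z := by
  unfold reForm
  rw [← map_add]
  congr 1
  ext w
  simp

lemma reForm_smul_left (c : ℂ) (x y : A ⊗[ℂ] B) :
    reForm s (c • x) y = c.re * reForm s x y + c.im * reForm s (Complex.I • x) y := by
  unfold reForm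
  rw [← smul_eq_mul, ← smul_eq_mul, ← map_smul, ← map_smul, ← map_add]
  congr 1
  ext w
  simp [mul_comm]

lemma reForm_I_smul_left (x y : A ⊗[ℂ] B) :
    reForm s (Complex.I • x) y = - reForm s x (Complex.I • y) := by
  unfold reForm
  rw [← map_neg]
  congr 1
  ext w
  simp

/-- The inner product on the algebraic tensor product defined by a positive functional. -/
abbrev functionalCore (hs : ∀ f : dominatedFunctions A B, (∀ z, 0 ≤ f.1 z) → 0 ≤ s f) :
    PreInnerProductSpace.Core ℂ (A ⊗[ℂ] B) where
  inner x y := ⟨reForm s x y, reForm s (Complex.I • x) y⟩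
  conj_inner_symm x y := by
    apply Complex.ext
    · simp [reForm_comm s y x]
    · simp [reForm_I_smul_left s x y, reForm_comm s (Complex.I • y) x]
  re_inner_nonneg x := hs _ fun z => by
    simpa using inner_self_nonneg (𝕜 := ℂ) (x := evalAt z x)
  add_left x y z := by
    apply Complex.ext
    · simp [reForm_add_left]
    · simp [reForm_add_left]
  smul_left x y c := by
    have h := reForm_smul_left s (Complex.I * c) x y
    apply Complex.ext
    · simp [reForm_smul_left s c]
    · simp [smul_smul, h]
      ring

end FunctionalGNS

section Similarity

open scoped TensorProduct

variable {A : Type u} [CStarAlgebra A] {B : Type v} [NonUnitalCStarAlgebra B]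
  {H : Type*} [NormedAddCommGroup H] [InnerProductSpace ℂ H] [CompleteSpace H]

lemma norm_evalAt_tensorLeft_le (a : A) (x : A ⊗[ℂ] B) (z : Σ p : CommutingPair A B, p.space) :
    ‖evalAt z (tensorLeft B a x)‖ ≤ ‖a‖ * ‖evalAt z x‖ := by
  rw [evalAt_apply, CommutingPair.eval_tensorLeft, mul_apply_eq_comp]
  exact ContinuousLinearMap.le_of_opNorm_le _ (NonUnitalStarAlgHom.norm_apply_le z.1.left a) _

lemma norm_evalAt_tensorRight_le (b : B) (x : A ⊗[ℂ] B) (z : Σ p : CommutingPair A B, p.space) :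
    ‖evalAt z (tensorRight A b x)‖ ≤ ‖b‖ * ‖evalAt z x‖ := by
  rw [evalAt_apply, CommutingPair.eval_tensorRight, mul_apply_eq_comp]
  exact ContinuousLinearMap.le_of_opNorm_le _ (NonUnitalStarAlgHom.norm_apply_le z.1.right b) _

lemma inner_evalAt_tensorLeft (a : A) (x y : A ⊗[ℂ] B) (z : Σ p : CommutingPair A B, p.space) :
    inner ℂ (evalAt z (tensorLeft B a x)) (evalAt z y)
      = inner ℂ (evalAt z x) (evalAt z (tensorLeft B (star a) y)) := by
  simp only [evalAt_apply, CommutingPair.eval_tensorLeft, mul_apply_eq_comp, map_star,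
    ContinuousLinearMap.star_eq_adjoint, ContinuousLinearMap.adjoint_inner_right]

lemma inner_evalAt_tensorRight (b : B) (x y : A ⊗[ℂ] B) (z : Σ p : CommutingPair A B, p.space) :
    inner ℂ (evalAt z (tensorRight A b x)) (evalAt z y)
      = inner ℂ (evalAt z x) (evalAt z (tensorRight A (star b) y)) := by
  simp only [evalAt_apply, CommutingPair.eval_tensorRight, mul_apply_eq_comp, map_star,
    ContinuousLinearMap.star_eq_adjoint, ContinuousLinearMap.adjoint_inner_right]

/-- A bounded representation of `A ⊗ B` of the form `σ(a) τ(b)` with a cyclic vector for `τ`, and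
with enough contractive rows, admits a positive invertible operator in the commutant of `τ(B)` which
intertwines `σ` and its adjoint. -/
theorem exists_intertwining_operator (σ : A →ₙₐ[ℂ] (H →L[ℂ] H)) (τ : B →⋆ₙₐ[ℂ] (H →L[ℂ] H))
    (hcomm : ∀ a b, Commute (σ a) (τ b)) (hτ : HasContractiveRows A τ) {C : ℝ} (hC : 0 ≤ C)
    (hT : ∀ (x : A ⊗[ℂ] B) (r : ℝ), 0 ≤ r → (∀ p : CommutingPair A B, ‖p.eval x‖ ≤ r) →
      ‖tensorMul (σ : A →ₗ[ℂ] (H →L[ℂ] H)) (τ : B →ₗ[ℂ] (H →L[ℂ] H)) x‖ ≤ C * r)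
    (ξ : H) (hξ : Dense (Set.range fun b => τ b ξ)) :
    ∃ Q : H →L[ℂ] H, star Q = Q ∧ (∃ κ : ℝ, 0 < κ ∧ ∀ g, κ * ‖g‖ ^ 2 ≤ (inner ℂ (Q g) g).re) ∧
      (∀ b, Commute (τ b) Q) ∧ ∀ a, star (σ a * Q) = σ (star a) * Q := by
  set T := tensorMul (σ : A →ₗ[ℂ] (H →L[ℂ] H)) (τ : B →ₗ[ℂ] (H →L[ℂ] H)) with hTdef
  have hTt (a : A) (b : B) : T (a ⊗ₜ b) = σ a * τ b := by simp [T]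
  have hTr (x : A ⊗[ℂ] B) (b : B) : T (tensorMulRight A b x) = T x * τ b := by
    induction x with
    | zero => simp
    | add x y hx hy => simp [hx, hy, add_mul]
    | tmul a c => simp [tensorMulRight, hTt, mul_assoc]
  have hTl (x : A ⊗[ℂ] B) (b : B) : T (tensorRight A b x) = τ b * T x := by
    induction x with
    | zero => simp
    | add x y hx hy => simp [hx, hy, mul_add]
    | tmul a c =>
      simp only [tensorRight, LinearMap.lTensor_tmul, LinearMap.mulLeft_apply, hTt, map_mul]
      rw [← mul_assoc, ← mul_assoc, (hcomm a b).eq]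
  have hTa (x : A ⊗[ℂ] B) (a : A) : T (tensorLeft B a x) = σ a * T x := by
    induction x with
    | zero => simp
    | add x y hx hy => simp [hx, hy, mul_add]
    | tmul a c => simp [tensorLeft, hTt, mul_assoc]
  obtain ⟨s, hs1, hs2⟩ := exists_dominating_functional T τ hτ hTr hTl hC hT ξ
  have hpos (f : dominatedFunctions A B) (hf : ∀ z, 0 ≤ f.1 z) : 0 ≤ s f := by
    have := hs1 (-f) [] fun z => by simpa [quadSum] using hf z
    simpa using this
  have hmono (x y : A ⊗[ℂ] B) (r : ℝ) (h : ∀ z, ‖evalAt z y‖ ≤ r * ‖evalAt z x‖) :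
      reForm s y y ≤ r ^ 2 * reForm s x x := by
    have h1 : 0 ≤ s (r ^ 2 • ⟨_, re_inner_evalAt_mem x x⟩ - ⟨_, re_inner_evalAt_mem y y⟩) := by
      refine hpos _ fun z => ?_
      have h2 := inner_self_eq_norm_sq (𝕜 := ℂ) (evalAt z x)
      have h3 := inner_self_eq_norm_sq (𝕜 := ℂ) (evalAt z y)
      simp only [RCLike.re_eq_complex_re] at h2 h3
      simp only [Submodule.coe_sub, Submodule.coe_smul, Pi.sub_apply, Pi.smul_apply, smul_eq_mul,
        h2, h3]
      rw [← mul_pow, sub_nonneg]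
      exact pow_le_pow_left₀ (norm_nonneg _) (h z) 2
    rw [map_sub, map_smul, smul_eq_mul] at h1
    exact sub_nonneg.1 h1
  let c := functionalCore s hpos
  let t : A ⊗[ℂ] B →ₗ[ℂ] H := (ContinuousLinearMap.apply ℂ H ξ).toLinearMap ∘ₗ T
  have ht (x : A ⊗[ℂ] B) : t x = T x ξ := rfl
  have hcre (x : A ⊗[ℂ] B) : (c.inner x x).re = reForm s x x := rfl
  obtain ⟨q, hq, hq0, hqt, hqi⟩ := exists_gramOperator c t fun x => hs2 x _ fun z => by
    simpa using inner_self_eq_norm_sq (𝕜 := ℂ) (evalAt z x)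
  have hadj (l l' : A ⊗[ℂ] B →ₗ[ℂ] A ⊗[ℂ] B) (h : ∀ x y z,
      inner ℂ (evalAt z (l x)) (evalAt z y) = inner ℂ (evalAt z x) (evalAt z (l' y))) (x y) :
      c.inner (l x) y = c.inner x (l' y) := by
    apply Complex.ext
    · exact reForm_congr s fun z => by rw [h]
    · refine reForm_congr s fun z => ?_
      rw [← map_smul l, h]
  have hqa (a : A) : star (σ a * q) = σ (star a) * q :=
    hqi (tensorLeft B a) (tensorLeft B (star a)) _ _ ‖a‖ (fun x => by simp [ht, hTa])
      (fun x => by simp [ht, hTa]) (hadj _ _ fun x y z => inner_evalAt_tensorLeft a x y z)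
      (fun x => hmono _ _ _ fun z => norm_evalAt_tensorLeft_le a x z)
      (fun x => hmono _ _ _ fun z => by
        simpa using norm_evalAt_tensorLeft_le (star a) x z)
  have hqb (b : B) : star (τ b * q) = τ (star b) * q :=
    hqi (tensorRight A b) (tensorRight A (star b)) _ _ ‖b‖ (fun x => by simp [ht, hTl])
      (fun x => by simp [ht, hTl]) (hadj _ _ fun x y z => inner_evalAt_tensorRight b x y z)
      (fun x => hmono _ _ _ fun z => norm_evalAt_tensorRight_le b x z)
      (fun x => hmono _ _ _ fun z => by
        simpa using norm_evalAt_tensorRight_le (star b) x z)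
  have hqcomm (b : B) : Commute (τ b) q := by
    have := hqb (star b)
    rw [star_mul, hq, map_star, star_star, star_star] at this
    exact this.symm
  -- the lower bound on the range of `σ 1`
  let P := σ 1
  set D := C * ‖(1 : A)‖ with hD
  have hlow1 (b : B) (g : H) :
      ‖inner ℂ (P (τ b ξ)) g‖ ^ 2 ≤ D ^ 2 * ‖τ b ξ‖ ^ 2 * (inner ℂ (q g) g).re := by
    have h1 := hqt ((1 : A) ⊗ₜ b) g
    have h2 : t ((1 : A) ⊗ₜ b) = P (τ b ξ) := by simp [ht, hTt, P]
    rw [h2, hcre] at h1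
    refine h1.trans (mul_le_mul_of_nonneg_right ?_ (hq0 g))
    have h3 := hs1 ⟨_, re_inner_evalAt_mem ((1 : A) ⊗ₜ b) ((1 : A) ⊗ₜ b)⟩
      [((‖(1 : A)‖ : ℝ) : ℂ) • b] fun z => by
        have h4 := inner_self_eq_norm_sq (𝕜 := ℂ) (evalAt z ((1 : A) ⊗ₜ[ℂ] b))
        simp only [RCLike.re_eq_complex_re] at h4
        simp only [h4, quadSum, List.map_cons, List.map_nil, List.sum_cons, List.sum_nil, add_zero]
        rw [map_smul, _root_.smul_apply, norm_smul, evalAt_apply, CommutingPair.eval_tmul,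
          mul_apply_eq_comp]
        refine pow_le_pow_left₀ (norm_nonneg _) ?_ 2
        simpa using ContinuousLinearMap.le_of_opNorm_le _
          (NonUnitalStarAlgHom.norm_apply_le z.1.left (1 : A)) _
    refine h3.trans (le_of_eq ?_)
    simp only [List.map_cons, List.map_nil, List.sum_cons, List.sum_nil, add_zero]
    rw [map_smul, _root_.smul_apply, norm_smul, hD]
    simp
    ring
  have hlow2 (h g : H) : ‖inner ℂ (P h) g‖ ^ 2 ≤ D ^ 2 * ‖h‖ ^ 2 * (inner ℂ (q g) g).re := by
    have hcl : IsClosed {h : H | ‖inner ℂ (P h) g‖ ^ 2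
        ≤ D ^ 2 * ‖h‖ ^ 2 * (inner ℂ (q g) g).re} :=
      isClosed_le (by fun_prop) (by fun_prop)
    refine hcl.closure_subset_iff.2 ?_ (hξ h)
    rintro _ ⟨b, rfl⟩
    exact hlow1 b g
  have hlow3 (g : H) : ‖star P g‖ ^ 2 ≤ D ^ 2 * (inner ℂ (q g) g).re := by
    have h1 := hlow2 (star P g) g
    have h2 : inner ℂ (P (star P g)) g = ((‖star P g‖ ^ 2 : ℝ) : ℂ) := by
      rw [ContinuousLinearMap.star_eq_adjoint, ← ContinuousLinearMap.adjoint_inner_right,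
        inner_self_eq_norm_sq_to_K]
      norm_cast
    rw [h2, Complex.norm_real, Real.norm_eq_abs, abs_of_nonneg (by positivity)] at h1
    rcases (sq_nonneg ‖star P g‖).eq_or_lt with h | h
    · rw [← h]
      exact mul_nonneg (sq_nonneg _) (hq0 g)
    · nlinarith
  have hPa (a : A) : σ a * (1 - P) = 0 := by
    rw [mul_sub, mul_one, ← map_mul, mul_one, sub_self]
  let R : H →L[ℂ] H := (1 - P) * star (1 - P)
  have hRg (g : H) : (inner ℂ (R g) g).re = ‖star (1 - P) g‖ ^ 2 := by
    rw [show R g = (1 - P) (star (1 - P) g) from rfl, ContinuousLinearMap.star_eq_adjoint,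
      ← ContinuousLinearMap.adjoint_inner_right, inner_self_eq_norm_sq_to_K]
    norm_cast
  have hPb (b : B) : Commute (τ b) (1 - P) :=
    (Commute.one_right _).sub_right (hcomm 1 b).symm
  refine ⟨q + R, ?_, ⟨(2 * (D ^ 2 + 1))⁻¹, by positivity, fun g => ?_⟩, fun b => ?_, fun a => ?_⟩
  · simp [R, hq]
  · rw [_root_.add_apply, inner_add_left, Complex.add_re, hRg, inv_mul_le_iff₀ (by positivity)]
    have h1 : g = star P g + star (1 - P) g := by simp
    have h2 : ‖g‖ ≤ ‖star P g‖ + ‖star (1 - P) g‖ := by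
      conv_lhs => rw [h1]
      exact norm_add_le _ _
    have h3 := hlow3 g
    have h4 := hq0 g
    nlinarith [sq_nonneg (‖star P g‖ - ‖star (1 - P) g‖), norm_nonneg g, sq_nonneg D,
      mul_nonneg (sq_nonneg D) (sq_nonneg ‖star (1 - P) g‖)]
  · refine (hqcomm b).add_right ((hPb b).mul_right ?_)
    have := (hPb (star b)).star_star
    rwa [map_star, star_star] at this
  · have h1 (a : A) : σ a * (q + R) = σ a * q := by
      rw [mul_add, ← mul_assoc, hPa, zero_mul, add_zero]
    rw [h1, h1, hqa]

end Similarity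

section Main

open scoped TensorProduct

/-- A copy of a Hilbert space in a higher universe. -/
def HilbertLift (H : Type v) : Type (max u v) := ULift.{u} H

instance {H : Type v} [NormedAddCommGroup H] : NormedAddCommGroup (HilbertLift.{u} H) :=
  inferInstanceAs (NormedAddCommGroup (ULift.{u} H))

instance {H : Type v} [NormedAddCommGroup H] [InnerProductSpace ℂ H] :
    InnerProductSpace ℂ (HilbertLift.{u} H) where
  __ := (inferInstanceAs (NormedSpace ℂ (ULift.{u} H)) : NormedSpace ℂ (ULift.{u} H))
  inner x y := inner ℂ x.down y.down
  norm_sq_eq_re_inner x := norm_sq_eq_re_inner (𝕜 := ℂ) x.down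
  conj_inner_symm x y := inner_conj_symm x.down y.down
  add_left x y z := inner_add_left x.down y.down z.down
  smul_left x y r := inner_smul_left x.down y.down r

instance {H : Type v} [NormedAddCommGroup H] [CompleteSpace H] :
    CompleteSpace (HilbertLift.{u} H) :=
  inferInstanceAs (CompleteSpace (ULift.{u} H))

/-- The isometric identification of a Hilbert space with its lift. -/
def HilbertLift.equiv (H : Type v) [NormedAddCommGroup H] [InnerProductSpace ℂ H] :
    HilbertLift.{u} H ≃ₗᵢ[ℂ] H where
  toFun := ULift.down
  invFun := ULift.up
  map_add' _ _ := rfl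
  map_smul' _ _ := rfl
  left_inv _ := rfl
  right_inv _ := rfl
  norm_map' _ := rfl

/-- Operators on a Hilbert space, viewed as operators on its lift. -/
def HilbertLift.hom (H : Type v) [NormedAddCommGroup H] [InnerProductSpace ℂ H] [CompleteSpace H] :
    (H →L[ℂ] H) →⋆ₙₐ[ℂ] (HilbertLift.{u} H →L[ℂ] HilbertLift.{u} H) where
  toFun x := (HilbertLift.equiv.{u} H).conjStarAlgEquiv.symm x
  map_smul' _ _ := map_smul _ _ _
  map_zero' := map_zero _
  map_add' _ _ := map_add _ _ _
  map_mul' _ _ := map_mul _ _ _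
  map_star' _ := map_star _ _

/-- Operators on the lift of a Hilbert space, viewed as operators on the space. -/
def HilbertLift.lower (H : Type v) [NormedAddCommGroup H] [InnerProductSpace ℂ H]
    [CompleteSpace H] : (HilbertLift.{u} H →L[ℂ] HilbertLift.{u} H) →⋆ₙₐ[ℂ] (H →L[ℂ] H) where
  toFun x := (HilbertLift.equiv.{u} H).conjStarAlgEquiv x
  map_smul' _ _ := ContinuousLinearMap.ext fun _ => rfl
  map_zero' := map_zero _
  map_add' _ _ := map_add _ _ _
  map_mul' _ _ := map_mul _ _ _
  map_star' _ := map_star _ _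

/-- The homomorphism `x ↦ w' Ψ(x) w` where `w w' = 1`. -/
def conjRep {X Y : Type*} [NonUnitalNonAssocSemiring X] [Module ℂ X] [Ring Y] [Algebra ℂ Y]
    (Ψ : X →ₙₐ[ℂ] Y) (w w' : Y) (h : w * w' = 1) : X →ₙₐ[ℂ] Y where
  toFun x := w' * Ψ x * w
  map_smul' c x := by simp
  map_zero' := by simp
  map_add' x y := by simp [mul_add, add_mul]
  map_mul' x y := by
    rw [map_mul]
    calc _ = w' * Ψ x * 1 * Ψ y * w := by simp only [mul_assoc, one_mul]
      _ = _ := by rw [← h]; simp only [mul_assoc]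

lemma conjRep_apply {X Y : Type*} [NonUnitalNonAssocSemiring X] [Module ℂ X] [Ring Y] [Algebra ℂ Y]
    (Ψ : X →ₙₐ[ℂ] Y) (w w' : Y) (h : w * w' = 1) (x : X) : conjRep Ψ w w' h x = w' * Ψ x * w := rfl

/-- Evaluation of the maximal tensor product in a commuting pair. -/
def MaxTensor.eval {A : Type u} {B : Type v} [NonUnitalCStarAlgebra A] [NonUnitalCStarAlgebra B]
    (p : CommutingPair A B) : MaxTensor A B →ₙₐ[ℂ] (p.space →L[ℂ] p.space) where
  toFun x := x.1 p
  map_smul' _ _ := rfl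
  map_zero' := rfl
  map_add' _ _ := rfl
  map_mul' _ _ := rfl

lemma MaxTensor.norm_eval_le {A : Type u} {B : Type v} [NonUnitalCStarAlgebra A]
    [NonUnitalCStarAlgebra B] (p : CommutingPair A B) (x : MaxTensor A B) :
    ‖MaxTensor.eval p x‖ ≤ ‖x‖ :=
  lp.norm_apply_le_norm ENNReal.top_ne_zero x.1 p

lemma MaxTensor.eval_maxTmul {A : Type u} {B : Type v} [NonUnitalCStarAlgebra A]
    [NonUnitalCStarAlgebra B] (p : CommutingPair A B) (a : A) (b : B) :
    MaxTensor.eval p (maxTmul a b) = p.left a * p.right b := rfl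

lemma MaxTensor.norm_le {A : Type u} {B : Type v} [NonUnitalCStarAlgebra A]
    [NonUnitalCStarAlgebra B] {x : MaxTensor A B} {r : ℝ} (hr : 0 ≤ r)
    (h : ∀ p, ‖MaxTensor.eval p x‖ ≤ r) : ‖x‖ ≤ r :=
  lp.norm_le_of_forall_le hr h

/-- A representation of the maximal tensor product restricts to the algebraic tensor product. -/
lemma MaxTensor.norm_tensorMul_le {A : Type u} {B : Type v} [CStarAlgebra A]
    [NonUnitalCStarAlgebra B] {Y : Type*} [NormedRing Y] [NormedAlgebra ℂ Y]
    (Φ : MaxTensor A B →ₙₐ[ℂ] Y) (σ : A →ₗ[ℂ] Y) (τ : B →ₗ[ℂ] Y)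
    (hΦ : ∀ a b, Φ (maxTmul a b) = σ a * τ b) {C : ℝ} (hC : ∀ y, ‖Φ y‖ ≤ C * ‖y‖)
    (x : A ⊗[ℂ] B) {r : ℝ} (hr : 0 ≤ r) (hx : ∀ p : CommutingPair A B, ‖p.eval x‖ ≤ r) :
    ‖tensorMul σ τ x‖ ≤ |C| * r := by
  have hlift : ∃ y : MaxTensor A B, (∀ p, MaxTensor.eval p y = p.eval x) ∧
      Φ y = tensorMul σ τ x := by
    clear hx
    induction x with
    | zero => exact ⟨0, fun p => by rw [map_zero, map_zero], by rw [map_zero, map_zero]⟩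
    | add x y hx hy =>
      obtain ⟨x', hx1, hx2⟩ := hx
      obtain ⟨y', hy1, hy2⟩ := hy
      refine ⟨x' + y', fun p => ?_, ?_⟩
      · rw [map_add (MaxTensor.eval p), map_add p.eval, hx1, hy1]
      · rw [map_add Φ, map_add (tensorMul σ τ), hx2, hy2]
    | tmul a b =>
      refine ⟨maxTmul a b, fun p => ?_, ?_⟩
      · rw [p.eval_tmul, MaxTensor.eval_maxTmul]
      · rw [hΦ, tensorMul_tmul]
  obtain ⟨y, hy1, hy2⟩ := hlift
  rw [← hy2]
  have hy : ‖y‖ ≤ r := MaxTensor.norm_le hr fun p => by rw [hy1]; exact hx p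
  exact (hC y).trans (mul_le_mul (le_abs_self C) hy (norm_nonneg _) (abs_nonneg C))

variable {H : Type v} [NormedAddCommGroup H] [InnerProductSpace ℂ H] [CompleteSpace H]

/-- The inclusion of `B(ℓ²)` into `B(H)`. -/
def actionHom (M : VonNeumannAlgebra H)
    (ρ : (EllTwo →L[ℂ] EllTwo) ≃⋆ₐ[ℂ] M.toStarSubalgebra) :
    (EllTwo →L[ℂ] EllTwo) →⋆ₐ[ℂ] (H →L[ℂ] H) :=
  M.toStarSubalgebra.subtype.comp (ρ : (EllTwo →L[ℂ] EllTwo) →⋆ₐ[ℂ] M.toStarSubalgebra)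

lemma actionHom_apply (M : VonNeumannAlgebra H)
    (ρ : (EllTwo →L[ℂ] EllTwo) ≃⋆ₐ[ℂ] M.toStarSubalgebra) (x : EllTwo →L[ℂ] EllTwo) :
    actionHom M ρ x = (ρ x : H →L[ℂ] H) := rfl

lemma actionHom_injective (M : VonNeumannAlgebra H)
    (ρ : (EllTwo →L[ℂ] EllTwo) ≃⋆ₐ[ℂ] M.toStarSubalgebra) :
    Function.Injective (actionHom M ρ) :=
  Subtype.val_injective.comp (EquivLike.injective ρ)

/-- The inclusion of a ⋆-subalgebra. -/
def inclusionHom (B : NonUnitalStarSubalgebra ℂ (H →L[ℂ] H)) : B →⋆ₙₐ[ℂ] (H →L[ℂ] H) :=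
  NonUnitalStarSubalgebraClass.subtype B

lemma inclusionHom_apply (B : NonUnitalStarSubalgebra ℂ (H →L[ℂ] H)) (b : B) :
    inclusionHom B b = (b : H →L[ℂ] H) := rfl

lemma actionHom_commute {M : VonNeumannAlgebra H}
    (ρ : (EllTwo →L[ℂ] EllTwo) ≃⋆ₐ[ℂ] M.toStarSubalgebra)
    {B : NonUnitalStarSubalgebra ℂ (H →L[ℂ] H)}
    (hB : IsWeaklyDenseIn (B : Set (H →L[ℂ] H)) (M.commutant : Set (H →L[ℂ] H)))
    (x : EllTwo →L[ℂ] EllTwo) (b : B) : Commute (actionHom M ρ x) (b : H →L[ℂ] H) :=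
  VonNeumannAlgebra.mem_commutant_iff.1 (hB.1 b.2) _ (ρ x).2

/-- A representation similar to a ⋆-representation induces a bounded representation of the maximal
tensor product. -/
theorem exists_bounded_of_isSimilarToStarRep {A : Type u} [CStarAlgebra A]
    (M : VonNeumannAlgebra H) (ρ : (EllTwo →L[ℂ] EllTwo) ≃⋆ₐ[ℂ] M.toStarSubalgebra)
    (B : NonUnitalStarSubalgebra ℂ (H →L[ℂ] H)) [IsClosed (B : Set (H →L[ℂ] H))]
    (hB : IsWeaklyDenseIn (B : Set (H →L[ℂ] H)) (M.commutant : Set (H →L[ℂ] H)))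
    (φ : A →ₙₐ[ℂ] (EllTwo →L[ℂ] EllTwo)) (h : IsSimilarToStarRep φ) :
    ∃ Φ : MaxTensor A B →ₙₐ[ℂ] (H →L[ℂ] H), IsBoundedRep Φ ∧
      ∀ (a : A) (b : B), Φ (maxTmul a b) = (ρ (φ a) : H →L[ℂ] H) * (b : H →L[ℂ] H) := by
  obtain ⟨S, π, hπ⟩ := h
  let p : CommutingPair A B :=
    { space := HilbertLift.{u} H
      left := ((HilbertLift.hom.{u} H).comp (actionHom M ρ).toNonUnitalStarAlgHom).comp π
      right := (HilbertLift.hom.{u} H).comp (inclusionHom B)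
      commute := fun a b => (actionHom_commute ρ hB (π a) b).map (HilbertLift.hom.{u} H) }
  let W : H →L[ℂ] H := actionHom M ρ S
  let W' : H →L[ℂ] H := actionHom M ρ ((S⁻¹ : (EllTwo →L[ℂ] EllTwo)ˣ) : EllTwo →L[ℂ] EllTwo)
  have hWW' : W * W' = 1 := by rw [← map_mul, Units.mul_inv, map_one]
  let Ψ : MaxTensor A B →ₙₐ[ℂ] (H →L[ℂ] H) :=
    NonUnitalAlgHom.comp (HilbertLift.lower.{u} H).toNonUnitalAlgHom (MaxTensor.eval p)
  have hΨ (x : MaxTensor A B) : Ψ x = HilbertLift.lower.{u} H (MaxTensor.eval p x) := rfl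
  refine ⟨conjRep Ψ W W' hWW', ⟨‖W'‖ * ‖W‖, fun x => ?_⟩, fun a b => ?_⟩
  · have h1 : ‖Ψ x‖ ≤ ‖x‖ :=
      (NonUnitalStarAlgHom.norm_apply_le (HilbertLift.lower.{u} H) (MaxTensor.eval p x)).trans
        (MaxTensor.norm_eval_le p x)
    calc ‖W' * Ψ x * W‖ ≤ ‖W'‖ * ‖Ψ x‖ * ‖W‖ :=
          (norm_mul_le _ _).trans (mul_le_mul_of_nonneg_right (norm_mul_le _ _) (norm_nonneg _))
      _ ≤ ‖W'‖ * ‖x‖ * ‖W‖ := by gcongr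
      _ = ‖W'‖ * ‖W‖ * ‖x‖ := by ring
  · have h1 : Ψ (maxTmul a b) = actionHom M ρ (π a) * (b : H →L[ℂ] H) := by
      rw [hΨ, MaxTensor.eval_maxTmul, map_mul]
      rfl
    rw [conjRep_apply]
    have h2 : φ a = ((S⁻¹ : (EllTwo →L[ℂ] EllTwo)ˣ) : EllTwo →L[ℂ] EllTwo) * π a * S := by
      rw [hπ]
      simp [mul_assoc]
    rw [h1, ← actionHom_apply, h2, map_mul, map_mul, mul_assoc, mul_assoc, mul_assoc, mul_assoc,
      ← (actionHom_commute ρ hB (S : EllTwo →L[ℂ] EllTwo) b).eq]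

/-- A representation intertwined with its adjoint by a positive invertible operator is similar to a
⋆-representation. -/
lemma isSimilarToStarRep_of_intertwining {A : Type u} [NonUnitalCStarAlgebra A]
    {φ : A →ₙₐ[ℂ] (H →L[ℂ] H)} {q : H →L[ℂ] H} (hq : 0 ≤ q) (hu : IsUnit q)
    (h : ∀ a, star (φ a * q) = φ (star a) * q) : IsSimilarToStarRep φ := by
  obtain ⟨r, hr⟩ := (CFC.isUnit_sqrt_iff q hq).2 hu
  have hrr : (r : H →L[ℂ] H) * r = q := by rw [hr]; exact CFC.sqrt_mul_sqrt_self q hq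
  have hrs : star (r : H →L[ℂ] H) = r := by rw [hr]; exact (CFC.sqrt_nonneg q).isSelfAdjoint
  have hrs' : star ((r⁻¹ : (H →L[ℂ] H)ˣ) : H →L[ℂ] H) = (r⁻¹ : (H →L[ℂ] H)ˣ) := by
    have : star r = r := Units.ext hrs
    rw [← Units.coe_star, star_inv, this]
  set ri : H →L[ℂ] H := ((r⁻¹ : (H →L[ℂ] H)ˣ) : H →L[ℂ] H) with hri
  have h1 : ri * r = 1 := Units.inv_mul r
  have h2 : (r : H →L[ℂ] H) * ri = 1 := Units.mul_inv r
  refine ⟨r⁻¹,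
    { conjRep φ (r : H →L[ℂ] H) ri h2 with
      map_star' := fun a => ?_ }, fun a => by simp [hri]; rfl⟩
  change ri * φ (star a) * r = star (ri * φ a * r)
  rw [star_mul, star_mul, hrs, hrs']
  have h3 := h a
  rw [star_mul, ← hrr, star_mul, hrs] at h3
  calc ri * φ (star a) * r = ri * (φ (star a) * (r * r)) * ri := by
        simp only [mul_assoc, h2, mul_one]
    _ = (ri * r) * (r * star (φ a)) * ri := by rw [← h3]; simp only [mul_assoc]
    _ = r * (star (φ a) * ri) := by rw [h1, one_mul, mul_assoc]

lemma mem_of_commute_weaklyDense {M : VonNeumannAlgebra H} {B : Set (H →L[ℂ] H)}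
    (hB : IsWeaklyDenseIn B (M.commutant : Set (H →L[ℂ] H))) {Q : H →L[ℂ] H}
    (hQ : ∀ b ∈ B, Commute b Q) : Q ∈ M := by
  rw [← M.commutant_commutant, VonNeumannAlgebra.mem_commutant_iff]
  intro y hy
  ext h
  rw [← sub_eq_zero]
  refine ext_inner_left ℂ fun g => ?_
  let F : (H →WOT[ℂ] H) → ℝ := fun T =>
    ‖InnerProductSpace.toDual ℂ H g (T (Q h)) - InnerProductSpace.toDual ℂ H (star Q g) (T h)‖
  have hF : Continuous F :=
    ((ContinuousLinearMapWOT.continuous_dual_apply _ _).sub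
      (ContinuousLinearMapWOT.continuous_dual_apply _ _)).norm
  have hFa (T : H →L[ℂ] H) :
      F (ContinuousLinearMapWOT.ofCLM T) = ‖inner ℂ g ((T * Q) h - (Q * T) h)‖ := by
    rw [inner_sub_right]
    simp [F, ContinuousLinearMap.star_eq_adjoint, ContinuousLinearMap.adjoint_inner_left]
  have := hB.le_of_forall_le hF (r := 0) (fun c hc => by
    rw [hFa, (hQ c hc).eq]; simp) hy
  rw [hFa] at this
  rw [inner_zero_right]
  exact norm_le_zero_iff.1 this

lemma dense_range_apply_of_separating {M : VonNeumannAlgebra H} {ξ : H}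
    (hsep : IsSeparatingVector (M : Set (H →L[ℂ] H)) ξ)
    {B : NonUnitalStarSubalgebra ℂ (H →L[ℂ] H)}
    (hB : IsWeaklyDenseIn (B : Set (H →L[ℂ] H)) (M.commutant : Set (H →L[ℂ] H))) :
    Dense (Set.range fun b : B => (b : H →L[ℂ] H) ξ) := by
  let L : Submodule ℂ H :=
    B.toSubmodule.map (ContinuousLinearMap.apply ℂ H ξ).toLinearMap
  have hL : (L : Set H) = Set.range fun b : B => (b : H →L[ℂ] H) ξ := by
    ext x
    constructor
    · rintro ⟨b, hb, rfl⟩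
      exact ⟨⟨b, hb⟩, rfl⟩
    · rintro ⟨b, rfl⟩
      exact ⟨b, b.2, rfl⟩
  let V : Submodule ℂ H := L.topologicalClosure
  have hVc : IsClosed (V : Set H) := Submodule.isClosed_topologicalClosure _
  have : CompleteSpace V := hVc.completeSpace_coe
  let P : H →L[ℂ] H := V.starProjection
  have hmem (b : B) : (b : H →L[ℂ] H) ξ ∈ V :=
    Submodule.le_topologicalClosure _ ⟨b, b.2, rfl⟩
  have hinv (b : B) (x : H) (hx : x ∈ V) : (b : H →L[ℂ] H) x ∈ V := by
    have hcl : IsClosed {x : H | (b : H →L[ℂ] H) x ∈ V} := hVc.preimage (b : H →L[ℂ] H).continuous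
    refine (hcl.closure_subset_iff (s := (L : Set H))).2 ?_ hx
    rintro _ ⟨c, hc, rfl⟩
    exact hmem (b * ⟨c, hc⟩)
  have hP : P ∈ M := by
    refine mem_of_commute_weaklyDense hB fun b hb => ?_
    have hsa : star P = P := isStarProjection_starProjection.isSelfAdjoint
    have h1 (b : B) : P * b * P = b * P := by
      ext x
      exact Submodule.starProjection_eq_self_iff.2 (hinv b _ (V.starProjection_apply_mem x))
    have h2 : star (P * star b * P) = star (star b * P) := congr(star $(h1 ⟨star b, star_mem hb⟩))
    have h3 : P * b * P = b * P := h1 ⟨b, hb⟩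
    simp only [star_mul, hsa, star_star] at h2
    exact h3.symm.trans ((mul_assoc _ _ _).trans h2)
  have hξ : ξ ∈ V := by
    rw [← Submodule.starProjection_eq_self_iff]
    by_contra hne
    have h1 : (1 : H →L[ℂ] H) ∈ M.commutant := one_mem _
    obtain ⟨g, hg⟩ : ∃ g, g = ξ - P ξ := ⟨_, rfl⟩
    have hg0 : g ≠ 0 := by rw [hg]; exact sub_ne_zero.2 (Ne.symm hne)
    have horth (x : H) (hx : x ∈ V) : inner ℂ g x = 0 := by
      rw [hg]
      exact Submodule.inner_left_of_mem_orthogonal hx (V.sub_starProjection_mem_orthogonal ξ)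
    let F : (H →WOT[ℂ] H) → ℝ := fun T => ‖InnerProductSpace.toDual ℂ H g (T ξ)‖
    have hF : Continuous F := (ContinuousLinearMapWOT.continuous_dual_apply _ _).norm
    have := hB.le_of_forall_le hF (r := 0) (fun c hc => by
      have := horth _ (hmem ⟨c, hc⟩)
      simp [F, this]) h1
    have h2 : inner ℂ g ξ = 0 := norm_le_zero_iff.1 (by simpa [F] using this)
    have h3 : inner ℂ g g = 0 := by
      conv_lhs => rw [hg, inner_sub_right, ← hg, h2, horth _ (V.starProjection_apply_mem ξ)]
      simp
    exact hg0 (inner_self_eq_zero.1 h3)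
  have h1P : 1 - P = 0 := by
    refine hsep _ (sub_mem (one_mem M) hP) ?_
    simp [P, Submodule.starProjection_eq_self_iff.2 hξ]
  intro x
  have hx : P x = x := by rw [← sub_eq_zero.1 h1P]; rfl
  have : x ∈ V := Submodule.starProjection_eq_self_iff.1 hx
  rw [← hL]
  exact this

lemma hasContractiveRows_inclusionHom (A : Type u) [CStarAlgebra A]
    {B : NonUnitalStarSubalgebra ℂ (H →L[ℂ] H)} [IsClosed (B : Set (H →L[ℂ] H))]
    {N : Set (H →L[ℂ] H)} (hB : IsWeaklyDenseIn (B : Set (H →L[ℂ] H)) N) {v : ℕ → H →L[ℂ] H}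
    (hvN : ∀ k, v k ∈ N) (hv : ∀ j k, star (v j) * v k = if j = k then 1 else 0) :
    HasContractiveRows A (inclusionHom B) := by
  intro n η ε hε
  obtain ⟨c, hc1, hc2⟩ := hB.exists_contractive_row hvN hv η hε
  refine ⟨c, fun p w => hc1 p.space p.right w, ?_⟩
  have hζ : ‖∑ k : Fin n, v k (η k)‖ = √(∑ k, ‖η k‖ ^ 2) := by
    rw [eq_comm, Real.sqrt_eq_iff_eq_sq (by positivity) (norm_nonneg _)]
    have h1 := inner_self_eq_norm_sq (𝕜 := ℂ) (∑ k : Fin n, v k (η k))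
    rw [← h1, sum_inner, map_sum]
    refine Finset.sum_congr rfl fun k _ => ?_
    rw [inner_sum, Finset.sum_eq_single k]
    · have h2 := congr($(hv k k) (η k))
      rw [if_pos rfl, mul_apply_eq_comp, ContinuousLinearMap.star_eq_adjoint] at h2
      rw [← ContinuousLinearMap.adjoint_inner_right, h2]
      exact (inner_self_eq_norm_sq (𝕜 := ℂ) (η k)).symm
    · intro j _ hj
      have h2 := congr($(hv k j) (η j))
      rw [if_neg fun h => hj (Fin.ext h.symm), mul_apply_eq_comp,
        ContinuousLinearMap.star_eq_adjoint] at h2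
      rw [← ContinuousLinearMap.adjoint_inner_right, h2]
      simp
    · simp
  rw [← hζ]
  have h3 := norm_sub_norm_le (∑ k : Fin n, v k (η k)) (∑ k, (c k : H →L[ℂ] H) (η k))
  simp only [inclusionHom_apply]
  linarith

lemma le_spectrum_of_le_inner {Q : H →L[ℂ] H} (hQ : star Q = Q) {κ : ℝ}
    (hκ : ∀ g, κ * ‖g‖ ^ 2 ≤ (inner ℂ (Q g) g).re) : ∀ t ∈ spectrum ℝ Q, κ ≤ t := by
  refine (algebraMap_le_iff_le_spectrum (p := IsSelfAdjoint) (a := Q) (ha := hQ)).1 ?_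
  rw [ContinuousLinearMap.le_def, ContinuousLinearMap.isPositive_def']
  refine ⟨?_, fun x => ?_⟩
  · rw [IsSelfAdjoint, star_sub, hQ]
    simp [Algebra.algebraMap_eq_smul_one]
  · rw [ContinuousLinearMap.reApplyInnerSelf_apply]
    have h1 := hκ x
    have h2 := inner_self_eq_norm_sq (𝕜 := ℂ) x
    simp only [RCLike.re_eq_complex_re] at h2 ⊢
    have h3 : (algebraMap ℝ (H →L[ℂ] H) κ) x = (κ : ℂ) • x := by
      simp [Algebra.algebraMap_eq_smul_one]
    rw [_root_.sub_apply, h3, inner_sub_left, inner_smul_left, Complex.sub_re,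
      Complex.conj_ofReal, Complex.re_ofReal_mul, h2]
    linarith

/-- A version of `isSimilarToStarRep_of_intertwining` in which positivity is checked in a faithful
representation. -/
lemma isSimilarToStarRep_of_faithful {A : Type u} [NonUnitalCStarAlgebra A] {K : Type*}
    [NormedAddCommGroup K] [InnerProductSpace ℂ K] [CompleteSpace K]
    (ι : (K →L[ℂ] K) →⋆ₐ[ℂ] (H →L[ℂ] H)) (hinj : Function.Injective ι)
    {φ : A →ₙₐ[ℂ] (K →L[ℂ] K)} {q : K →L[ℂ] K} (hqs : star (ι q) = ι q) {κ : ℝ} (hκ : 0 < κ)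
    (hqκ : ∀ g, κ * ‖g‖ ^ 2 ≤ (inner ℂ (ι q g) g).re)
    (h : ∀ a, star (ι (φ a) * ι q) = ι (φ (star a)) * ι q) : IsSimilarToStarRep φ := by
  have hqs' : IsSelfAdjoint q := hinj (by rw [map_star, hqs])
  have hspec : ∀ t ∈ spectrum ℝ q, κ ≤ t := by
    rw [← hqs'.map_spectrum_real ι hinj]
    exact le_spectrum_of_le_inner hqs hqκ
  have hq0 : 0 ≤ q := by
    rw [StarOrderedRing.nonneg_iff_spectrum_nonneg (R := ℝ) q hqs']
    exact fun t ht => hκ.le.trans (hspec t ht)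
  have hqu : IsUnit q := by
    rw [← spectrum.zero_notMem_iff ℝ]
    exact fun h0 => absurd (hspec 0 h0) (not_le.2 hκ)
  refine isSimilarToStarRep_of_intertwining hq0 hqu fun a => hinj ?_
  rw [map_star, map_mul, map_mul, h]

/-- A bounded representation inducing a bounded representation of the maximal tensor product is
similar to a ⋆-representation. -/
theorem isSimilarToStarRep_of_exists_bounded {A : Type u} [CStarAlgebra A]
    (M : VonNeumannAlgebra H) (ρ : (EllTwo →L[ℂ] EllTwo) ≃⋆ₐ[ℂ] M.toStarSubalgebra)
    (ξ : H) (hsep : IsSeparatingVector (M : Set (H →L[ℂ] H)) ξ)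
    (B : NonUnitalStarSubalgebra ℂ (H →L[ℂ] H)) [IsClosed (B : Set (H →L[ℂ] H))]
    (hB : IsWeaklyDenseIn (B : Set (H →L[ℂ] H)) (M.commutant : Set (H →L[ℂ] H)))
    (φ : A →ₙₐ[ℂ] (EllTwo →L[ℂ] EllTwo))
    (Φ : MaxTensor A B →ₙₐ[ℂ] (H →L[ℂ] H)) (hΦ : IsBoundedRep Φ)
    (hΦt : ∀ (a : A) (b : B),
      Φ (maxTmul a b) = (ρ (φ a) : H →L[ℂ] H) * (b : H →L[ℂ] H)) :
    IsSimilarToStarRep φ := by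
  let σ : A →ₙₐ[ℂ] (H →L[ℂ] H) :=
    { toFun := fun a => actionHom M ρ (φ a)
      map_smul' := fun c a => by simp
      map_zero' := by simp
      map_add' := fun a b => by simp
      map_mul' := fun a b => by simp }
  have hσ (a : A) : σ a = actionHom M ρ (φ a) := rfl
  obtain ⟨v, hvM, hv⟩ := exists_isometries_mem_commutant M ρ ξ hsep
  have hrows := hasContractiveRows_inclusionHom A hB hvM hv
  obtain ⟨C, hC⟩ := hΦ
  obtain ⟨Q, hQs, ⟨κ, hκ, hQκ⟩, hQB, hQa⟩ :=
    exists_intertwining_operator σ (inclusionHom B)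
      (fun a b => actionHom_commute ρ hB (φ a) b) hrows (abs_nonneg C)
      (fun x r hr hx => MaxTensor.norm_tensorMul_le Φ _ _ hΦt hC x hr hx) ξ
      (dense_range_apply_of_separating hsep hB)
  have hQM : Q ∈ M := mem_of_commute_weaklyDense hB fun b hb => hQB ⟨b, hb⟩
  obtain ⟨q, hq⟩ := EquivLike.surjective ρ ⟨Q, hQM⟩
  have hqQ : actionHom M ρ q = Q := congr(($hq : H →L[ℂ] H))
  subst hqQ
  exact isSimilarToStarRep_of_faithful _ (actionHom_injective M ρ) hQs hκ hQκ hQa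

end Main

end

theorem mainTheorem8 {H : Type*} [NormedAddCommGroup H] [InnerProductSpace ℂ H] [CompleteSpace H]
    (M : VonNeumannAlgebra H) (ρ : (EllTwo →L[ℂ] EllTwo) ≃⋆ₐ[ℂ] M.toStarSubalgebra)
    (ξ : H) (hcyc : IsCyclicVector (M : Set (H →L[ℂ] H)) ξ)
    (hsep : IsSeparatingVector (M : Set (H →L[ℂ] H)) ξ)
    (B : NonUnitalStarSubalgebra ℂ (H →L[ℂ] H)) [IsClosed (B : Set (H →L[ℂ] H))]
    (hB : IsWeaklyDenseIn (B : Set (H →L[ℂ] H)) (M.commutant : Set (H →L[ℂ] H)))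
    (φ : CStarFInfty →ₙₐ[ℂ] (EllTwo →L[ℂ] EllTwo)) (hφ : IsBoundedRep φ) :
    IsSimilarToStarRep φ ↔
      ∃ Φ : MaxTensor CStarFInfty B →ₙₐ[ℂ] (H →L[ℂ] H), IsBoundedRep Φ ∧
        ∀ (a : CStarFInfty) (b : B),
          Φ (maxTmul a b) = (ρ (φ a) : H →L[ℂ] H) * (b : H →L[ℂ] H) := by
  constructor
  · exact exists_bounded_of_isSimilarToStarRep M ρ B hB φ
  · rintro ⟨Φ, hΦ, hΦt⟩
    exact isSimilarToStarRep_of_exists_bounded M ρ ξ hsep B hB φ Φ hΦ hΦt
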